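/- Let $E$ be a finite-dimensional real Euclidean space with inner product $\langle\cdot,\cdot\rangle$, and let $R\subset E$ be a reduced irreducible crystallographic root system spanning $E$, with simple roots $\alpha_1,\dots,\alpha_n$, highest root $\xi$, coroots $\beta^\vee=2\beta/\langle\beta,\beta\rangle$, orthogonal reflections $r_\beta$ ($\beta\in R$), Weyl group $W$, and even Weyl group $W_e=\{w\in W:\det w=1\}$. Fix an arbitrary root $\alpha\in R$. Let - $D_+=\{x\in E:\langle x,\alpha_i\rangle\ge 0 \text{ for all } i\}$ and $D^e_+=D_+\cup r_\alpha D_+$; - $P=\{\lambda\in E:\langle\lambda,\alpha_i^\vee\rangle\in\mathbb Z\text{ for all } i\}$, $P_+=P\cap D_+$, and $P_+^+=\{\lambda\in P:\langle\lambda,\alpha_i\rangle>0\text{ for all } i\}$; - $P^e_+=P_+\cup r_\alpha P_+^+$, that is, the union $P_+\cup r_\alpha P_+$ in which $W_e$-equivalent points are taken only once; - $\overline F=\{x\in D_+:\langle x,\xi\rangle\le 1\}$ and $\overline{F_e}=\overline F\cup r_\alpha\overline F$, the closure of the fundamental domain of the even affine Weyl group; - $\mathsf T=\{\sum_i c_i\alpha_i^\vee: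 0\le c_i<1\}$, a realization of the torus $E/\bigoplus_i\mathbb Z\alpha_i^\vee$. For $\lambda\in E$ let $O_e(\lambda)=W_e\lambda$, let $W_\lambda=\{w\in W_e: w\lambda=\lambda\}$, and define the $E$-orbit function $$E_\lambda(x)=\sum_{\mu\in O_e(\lambda)}e^{2\pi i\langle\mu,x\rangle},\qquad x\in E .$$ (a) Let $\lambda,\lambda'\in P_+\cup r_\alpha P_+$ with $\lambda$ in the interior of $D^e_+$ (that is, not on a wall of $D^e_+$). With respect to Lebesgue measure $dx$, $$|\overline{F_e}|^{-1}\int_{\overline{F_e}}E_\lambda(x)\overline{E_{\lambda'}(x)}\,dx=|W_e|\,\delta_{\lambda\lambda'} .$$ If Lebesgue measure is rescaled so that $|\mathsf T|=1$, then $$\int_{\mathsf T}E_\lambda(x)\overline{E_{\lambda'}(x)}\,dx=|W_e|\,\delta_{\lambda\lambda'},\qquad \int_{\overline{F_e}}E_\lambda(x)\overline{E_{\lambda'}(x)}\,dx=\delta_{\lambda\lambda'} .$$ (b) With Lebesgue measure rescaled so that $|\mathsf T|=1$, for all $\lambda,\lambda'\in P^e_+$, in particular when $\lambda$ lies on a wall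 of $D^e_+$, $$\int_{\overline{F_e}}E_\lambda(x)\overline{E_{\lambda'}(x)}\,dx=|W_\lambda|^{-1}\,\delta_{\lambda\lambda'} .$$ More generally, for all $\lambda,\lambda'\in P_+\cup r_\alpha P_+$ the same integral equals $|W_\lambda|^{-1}$ if $O_e(\lambda)=O_e(\lambda')$ and $0$ otherwise. (c) With this rescaling, $|\overline{F_e}|=|W_e|^{-1}$. For all $\lambda,\lambda'\in E$ the function $E_\lambda\overline{E_{\lambda'}}$ is integrable on $\overline{F_e}$ and on $\mathsf T$. -/

import Mathlib

open MeasureTheory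
open scoped InnerProductSpace ComplexConjugate

namespace EOrbit

variable {ι E : Type*} [NormedAddCommGroup E] [InnerProductSpace ℝ E]

/-- A root pairing of a Euclidean space with itself is *Euclidean* if the pairing is the inner
product and `α^∨ = 2 α / ⟨α, α⟩` for every root `α`; equivalently, the reflections attached to the
roots are the orthogonal reflections `x ↦ x - (2⟨x, α⟩ / ⟨α, α⟩) α`. -/
class IsEuclidean (P : RootPairing ι ℝ E E) : Prop where
  pairing_eq_inner : ∀ x y : E, P.toLinearMap x y = ⟪x, y⟫_ℝ
  coroot_eq : ∀ i, P.coroot i = (2 / ⟪P.root i, P.root i⟫_ℝ) • P.root i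

/-- The root with index `ξ` is the highest root: every root is obtained from it by subtracting
simple roots. -/
def IsHighestRoot {P : RootPairing ι ℝ E E} (b : P.Base) (ξ : ι) : Prop :=
  ∀ i, P.root ξ - P.root i ∈ AddSubmonoid.closure (P.root '' b.support)

/-- The even Weyl group `W_e`: the elements of determinant one of the Weyl group, regarded as a
group of linear transformations of `E`. -/
noncomputable def evenWeyl (P : RootPairing ι ℝ E E) : Subgroup (E ≃ₗ[ℝ] E) :=
  P.weylGroup.map (RootPairing.Equiv.weightHom P) ⊓ (LinearEquiv.det (R := ℝ) (M := E)).ker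

/-- The even Weyl group of a finite root system is finite, hence so are its orbits. -/
theorem finite_evenWeyl [Finite ι] (P : RootPairing ι ℝ E E) [P.IsRootSystem] : Finite (evenWeyl P) := by
  have : Finite (P.weylGroup) := by
    refine Finite.of_injective (fun g : P.weylGroup => RootPairing.Equiv.indexHom P g.1) ?_
    intro g h hgh
    apply Subtype.ext
    apply RootPairing.Equiv.weightHom_injective
    apply LinearEquiv.toLinearMap_injective
    apply LinearMap.ext_on (RootPairing.IsRootSystem.span_root_eq_top (P := P))
    rintro _ ⟨i, rfl⟩
    have h1 := P.weylGroup_apply_root g i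
    have h2 := P.weylGroup_apply_root h i
    have h3 : P.weylGroupToPerm g i = P.weylGroupToPerm h i := congrArg (fun e => e i) hgh
    exact h1.trans ((congrArg P.root h3).trans h2.symm)
  have h2 : ((P.weylGroup.map (RootPairing.Equiv.weightHom P) : Subgroup _) : Set (E ≃ₗ[ℝ] E)).Finite := by
    rw [Subgroup.coe_map]
    exact (Set.toFinite (SetLike.coe P.weylGroup)).image _
  exact (h2.subset (fun x hx => hx.1)).to_subtype

/-- The `W_e`-orbit `O_e(lam)`. -/
noncomputable def evenOrbit (P : RootPairing ι ℝ E E) (lam : E) : Set E :=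
  MulAction.orbit (evenWeyl P) lam

/-- The subgroup `W_lam` of `W_e` fixing `lam`. -/
noncomputable def evenStabilizer (P : RootPairing ι ℝ E E) (lam : E) : Subgroup (evenWeyl P) :=
  MulAction.stabilizer (evenWeyl P) lam

/-- The order `|W_e|`. -/
noncomputable def evenOrder (P : RootPairing ι ℝ E E) : ℕ := Nat.card (evenWeyl P)

/-- The order `|W_lam|`. -/
noncomputable def stabilizerOrder (P : RootPairing ι ℝ E E) (lam : E) : ℕ :=
  Nat.card (evenStabilizer P lam)

/-- The `E`-orbit function `E_lam(x) = ∑_{μ ∈ O_e(lam)} exp (2 π i ⟨μ, x⟩)`. The orbit is finite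
for every finite root system. -/
noncomputable def orbitFunction (P : RootPairing ι ℝ E E) (lam x : E) : ℂ :=
  ∑ᶠ μ ∈ evenOrbit P lam, Complex.exp (2 * Real.pi * Complex.I * (⟪μ, x⟫_ℝ : ℂ))

/-- The closed dominant Weyl chamber `D_+`. -/
def dominantChamber {P : RootPairing ι ℝ E E} (b : P.Base) : Set E :=
  {x | ∀ i ∈ b.support, 0 ≤ ⟪x, P.root i⟫_ℝ}

/-- The even dominant Weyl chamber `D^e_+ = D_+ ∪ r_α D_+`. -/
def evenDominantChamber {P : RootPairing ι ℝ E E} (b : P.Base) (α : ι) : Set E :=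
  dominantChamber b ∪ P.reflection α '' dominantChamber b

/-- The weight lattice: all vectors having integral inner products with the simple coroots. -/
def weightLattice {P : RootPairing ι ℝ E E} (b : P.Base) : Set E :=
  {lam | ∀ i ∈ b.support, ∃ m : ℤ, ⟪lam, P.coroot i⟫_ℝ = m}

/-- The cone `P_+` of dominant integral weights. -/
def dominantWeights {P : RootPairing ι ℝ E E} (b : P.Base) : Set E :=
  weightLattice b ∩ dominantChamber b

/-- The set `P_+^+` of strictly dominant integral weights. -/
def strictlyDominantWeights {P : RootPairing ι ℝ E E} (b : P.Base) : Set E :=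
  {lam ∈ weightLattice b | ∀ i ∈ b.support, 0 < ⟪lam, P.root i⟫_ℝ}

/-- The full union `P_+ ∪ r_α P_+`. It meets every `W_e`-orbit of integral weights, but may meet
the orbit of a weight on a wall in two points. -/
def evenDominantWeightsFull {P : RootPairing ι ℝ E E} (b : P.Base) (α : ι) : Set E :=
  dominantWeights b ∪ P.reflection α '' dominantWeights b

/-- The set `P^e_+`: the union of `P_+` and `r_α P_+` in which the points are taken only once
modulo `W_e`. Since a weight `lam` on a wall and `r_α lam` are in the same `W_e`-orbit, this is
`P_+ ∪ r_α P_+^+`. -/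
def evenDominantWeights {P : RootPairing ι ℝ E E} (b : P.Base) (α : ι) : Set E :=
  dominantWeights b ∪ P.reflection α '' strictlyDominantWeights b

/-- The closure of the fundamental domain `F` of the affine Weyl group: the simplex of all
dominant `x` with `⟨x, ξ⟩ ≤ 1`, where `ξ` is the highest root. -/
def closedAlcove {P : RootPairing ι ℝ E E} (b : P.Base) (ξ : ι) : Set E :=
  {x ∈ dominantChamber b | ⟪x, P.root ξ⟫_ℝ ≤ 1}

/-- The closure of the fundamental domain `F_e` of the even affine Weyl group: the union of the
closed simplex `F` and of its image under `r_α`. -/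
def closedEvenAlcove {P : RootPairing ι ℝ E E} (b : P.Base) (ξ α : ι) : Set E :=
  closedAlcove b ξ ∪ P.reflection α '' closedAlcove b ξ

/-- The torus `T = E / Q^∨`, realised as the half-open parallelepiped spanned by the simple
coroots. -/
def torus {P : RootPairing ι ℝ E E} [P.IsRootSystem] (b : P.Base) : Set E :=
  ZSpan.fundamentalDomain b.toCoweightBasis

/-- Lebesgue measure rescaled so that the torus has volume one. -/
noncomputable def torusMeasure [FiniteDimensional ℝ E] [MeasurableSpace E] [BorelSpace E]
    {P : RootPairing ι ℝ E E} [P.IsRootSystem] (b : P.Base) : Measure E :=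
  (volume (torus b))⁻¹ • volume

/-- The Kronecker symbol. -/
noncomputable def kronecker {X : Type*} (a b : X) : ℂ :=
  open scoped Classical in if a = b then 1 else 0

end EOrbit

/-! The coroot lattice and the Weyl group $W$ generate the affine Weyl group, whose images of the
alcove tile $E$. For any root $\alpha$ the reflection $r_\alpha$ has determinant $-1$, so
$W=W_e\sqcup W_er_\alpha$; hence the $W_e$-images of the doubled alcove fill, up to a null set, a
fundamental domain of the coroot lattice. The torus is another such domain, so an integral over it
of a function invariant under $W_e$ and the lattice is $|W_e|$ times the integral over
$\overline{F_e}$ (`setIntegral_torus_eq`). Orbit functions of integral weights are invariant in this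
way. On the torus they are sums of distinct characters, and orthogonality of characters counts the
common elements of two orbits: $|O_e(\lambda)|=|W_e|/|W_\lambda|$ or none.

The main work is the tiling. The wall reflections generate the affine group
(`affineReflection_mem_closure`), so its elements are words. A word carrying an interior point of
the alcove back into the alcove can be shortened until it is empty (`exchange`,
`list_prod_eq_one_of_mem_openAlcove`), because a wall is the only hyperplane separating the alcove
from its mirror image in that wall (`affineReflection_eq_of_sign_change`). The tiles cover because,
among the points of an affine orbit, one nearest to a fixed interior point lies in the closed alcove
(`exists_apply_add_mem_closedAlcove`).

To compare weights instead of orbits, points of $D_+$ are scaled into the alcove: $W$-equivalent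
ones coincide, and strictly dominant ones have trivial stabilizer. This separates the points of
$P^e_+$. For $\lambda$ interior to $D^e_+$, a small perturbation shows that only $1$ and possibly
$r_\alpha$ fix it in $W$, so $W_\lambda$ is trivial. -/

namespace EOrbit

/-! ### Reflections in the affine hyperplanes of the root system. -/

section AffineReflections

variable {ι E : Type*} [NormedAddCommGroup E] [InnerProductSpace ℝ E]
  (P : RootPairing ι ℝ E E) [IsEuclidean P]

theorem reflection_apply_eq (i : ι) (x : E) :
    P.reflection i x = x - ⟪x, P.root i⟫_ℝ • P.coroot i := by
  rw [RootPairing.reflection_apply, LinearMap.flip_apply, IsEuclidean.pairing_eq_inner,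
    IsEuclidean.coroot_eq (P := P), inner_smul_right, smul_smul]
  congr 2
  ring

theorem inner_root_coroot (i j : ι) : ⟪P.root i, P.coroot j⟫_ℝ = P.pairing i j := by
  rw [← IsEuclidean.pairing_eq_inner (P := P)]
  rfl

theorem inner_coroot_root (i j : ι) : ⟪P.coroot j, P.root i⟫_ℝ = P.pairing i j := by
  rw [real_inner_comm, inner_root_coroot]

theorem inner_reflection_reflection (i : ι) (x y : E) :
    ⟪P.reflection i x, P.reflection i y⟫_ℝ = ⟪x, y⟫_ℝ := by
  have h2 : ⟪P.root i, P.coroot i⟫_ℝ = 2 := by rw [inner_root_coroot, P.pairing_same]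
  rw [IsEuclidean.coroot_eq (P := P), inner_smul_right] at h2
  simp only [reflection_apply_eq, inner_sub_left, inner_sub_right, inner_smul_left,
    inner_smul_right, IsEuclidean.coroot_eq (P := P), RCLike.conj_to_real]
  rw [real_inner_comm (P.root i) x]
  linear_combination (2 / ⟪P.root i, P.root i⟫_ℝ) * ⟪P.root i, x⟫_ℝ * ⟪P.root i, y⟫_ℝ * h2
    + ((2 / ⟪P.root i, P.root i⟫_ℝ) ^ 2 * ⟪P.root i, P.root i⟫_ℝ * ⟪P.root i, x⟫_ℝ
      - (2 / ⟪P.root i, P.root i⟫_ℝ) * ⟪P.root i, x⟫_ℝ) * real_inner_comm (P.root i) y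

theorem inner_reflection_left (i : ι) (x y : E) :
    ⟪P.reflection i x, y⟫_ℝ = ⟪x, P.reflection i y⟫_ℝ := by
  rw [← inner_reflection_reflection P i, P.reflection_same]

theorem reflection_coroot (i j : ι) :
    P.reflection i (P.coroot j) = P.coroot (P.reflectionPerm i j) := by
  rw [reflection_apply_eq, inner_coroot_root, ← P.reflectionPerm_coroot i j]
  rfl

/-- The affine function `x ↦ ⟨x, β⟩ + k` attached to a pair `(β, k)`. -/
noncomputable def affineForm (c : ι × ℤ) (x : E) : ℝ := ⟪x, P.root c.1⟫_ℝ + c.2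

theorem affineForm_sub_smul_coroot (c : ι × ℤ) (d : ι) (x : E) (t : ℝ) :
    affineForm P c (x - t • P.coroot d) = affineForm P c x - t * P.pairing c.1 d := by
  simp only [affineForm, inner_sub_left, inner_smul_left, inner_coroot_root, RCLike.conj_to_real]
  ring

theorem affineForm_reflection_self (c : ι × ℤ) (x : E) :
    affineForm P c (x - affineForm P c x • P.coroot c.1) = -affineForm P c x := by
  rw [affineForm_sub_smul_coroot, P.pairing_same]
  ring

/-- The orthogonal reflection in the hyperplane `⟨x, β⟩ + k = 0`. -/
noncomputable def affineReflection (c : ι × ℤ) : Equiv.Perm E :=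
  Function.Involutive.toPerm (fun x => x - affineForm P c x • P.coroot c.1) fun x => by
    simp only [affineForm_reflection_self]
    module

theorem affineReflection_apply (c : ι × ℤ) (x : E) :
    affineReflection P c x = x - affineForm P c x • P.coroot c.1 := rfl

theorem affineForm_affineReflection_self (c : ι × ℤ) (x : E) :
    affineForm P c (affineReflection P c x) = -affineForm P c x :=
  affineForm_reflection_self P c x

theorem affineReflection_mul_self (c : ι × ℤ) : affineReflection P c * affineReflection P c = 1 := by
  ext x
  exact Function.Involutive.toPerm_involutive _ x

theorem affineReflection_inv (c : ι × ℤ) : (affineReflection P c)⁻¹ = affineReflection P c :=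
  inv_eq_of_mul_eq_one_left (affineReflection_mul_self P c)

theorem affineReflection_eq (c : ι × ℤ) (x : E) :
    affineReflection P c x = P.reflection c.1 x - (c.2 : ℝ) • P.coroot c.1 := by
  rw [affineReflection_apply, reflection_apply_eq, affineForm]
  module

/-- Each hyperplane carries two labels of opposite sign; this permits choosing the one that is
positive at a given point. -/
theorem affineReflection_eq_of_neg (i : ι) (k : ℤ) :
    affineReflection P (P.reflectionPerm i i, -k) = affineReflection P (i, k) := by
  ext x
  have hc : P.coroot (P.reflectionPerm i i) = -P.coroot i :=
    (P.coroot_eq_neg_iff (i := P.reflectionPerm i i) (j := i)).2 rfl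
  have hr : P.root (P.reflectionPerm i i) = -P.root i :=
    (P.root_eq_neg_iff (i := P.reflectionPerm i i) (j := i)).2 rfl
  simp only [affineReflection_apply, affineForm, hc, hr, inner_neg_right, Int.cast_neg]
  module

variable [P.IsCrystallographic]

omit [IsEuclidean P] in
theorem exists_pairing_eq_int (i j : ι) : ∃ n : ℤ, P.pairing i j = n :=
  ⟨P.pairingIn ℤ i j, (P.algebraMap_pairingIn ℤ i j).symm⟩

/-- Integrality of the Cartan numbers keeps the constant term an integer, so reflections permute the
affine roots and conjugate the corresponding reflections. -/
theorem exists_affineForm_comp_affineReflection (b d : ι × ℤ) :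
    ∃ b' : ι × ℤ, (∀ x, affineForm P b' x = affineForm P b (affineReflection P d x)) ∧
      affineReflection P b' = affineReflection P d * affineReflection P b * affineReflection P d := by
  obtain ⟨n, hn⟩ := exists_pairing_eq_int P b.1 d.1
  have key : ∀ x, affineForm P (P.reflectionPerm d.1 b.1, b.2 - d.2 * n) x =
      affineForm P b (affineReflection P d x) := by
    intro x
    simp only [affineReflection_eq, affineForm_sub_smul_coroot, hn]
    simp only [affineForm, P.root_reflectionPerm, inner_reflection_left]
    push_cast
    ring
  refine ⟨(P.reflectionPerm d.1 b.1, b.2 - d.2 * n), key, ?_⟩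
  ext x
  rw [Equiv.Perm.mul_apply, Equiv.Perm.mul_apply, affineReflection_apply, key,
    affineReflection_apply P b, affineReflection_eq P d (_ - _), map_sub, map_smul,
    reflection_coroot, sub_right_comm, ← affineReflection_eq, ← Equiv.Perm.mul_apply,
    affineReflection_mul_self]
  rfl

end AffineReflections

/-! ### Signs of affine roots on the fundamental alcove. -/

section Alcove

variable {ι E : Type*} [NormedAddCommGroup E] [InnerProductSpace ℝ E]
  {P : RootPairing ι ℝ E E} (b : P.Base) (ξ : ι)

/-- The affine roots `(α_i, 0)` and `(-ξ, 1)` whose zero sets are the walls of the alcove. -/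
def simpleAffineRoots : Set (ι × ℤ) :=
  {c | c.1 ∈ b.support ∧ c.2 = 0} ∪ {(P.reflectionPerm ξ ξ, 1)}

/-- The open fundamental alcove. -/
def openAlcove : Set E := {x | ∀ c ∈ simpleAffineRoots b ξ, 0 < affineForm P c x}

variable {b ξ}

theorem affineForm_neg_one (x : E) :
    affineForm P (P.reflectionPerm ξ ξ, 1) x = 1 - ⟪x, P.root ξ⟫_ℝ := by
  have hr : P.root (P.reflectionPerm ξ ξ) = -P.root ξ :=
    (P.root_eq_neg_iff (i := P.reflectionPerm ξ ξ) (j := ξ)).2 rfl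
  simp only [affineForm, hr, inner_neg_right, Int.cast_one]
  ring

theorem mem_openAlcove {x : E} :
    x ∈ openAlcove b ξ ↔ (∀ i ∈ b.support, 0 < ⟪x, P.root i⟫_ℝ) ∧ ⟪x, P.root ξ⟫_ℝ < 1 := by
  constructor
  · intro h
    refine ⟨fun i hi => ?_, ?_⟩
    · simpa [affineForm] using h (i, 0) (Or.inl ⟨hi, rfl⟩)
    · have := h _ (Or.inr rfl)
      rw [affineForm_neg_one] at this
      linarith
  · rintro ⟨h1, h2⟩ ⟨i, k⟩ (⟨hi, hk⟩ | hc)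
    · simp only at hi hk
      subst hk
      simpa [affineForm] using h1 i hi
    · rw [Set.mem_singleton_iff.1 hc, affineForm_neg_one]
      linarith

theorem mem_closedAlcove {x : E} :
    x ∈ closedAlcove b ξ ↔ ∀ c ∈ simpleAffineRoots b ξ, 0 ≤ affineForm P c x := by
  constructor
  · rintro ⟨h1, h2⟩ ⟨i, k⟩ (⟨hi, hk⟩ | hc)
    · simp only at hi hk
      subst hk
      simpa [affineForm] using h1 i hi
    · rw [Set.mem_singleton_iff.1 hc, affineForm_neg_one]
      linarith
  · intro h
    refine ⟨fun i hi => ?_, ?_⟩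
    · simpa [affineForm] using h (i, 0) (Or.inl ⟨hi, rfl⟩)
    · have := h _ (Or.inr rfl)
      rw [affineForm_neg_one] at this
      linarith

theorem openAlcove_subset_closedAlcove : openAlcove b ξ ⊆ closedAlcove b ξ :=
  fun _ hx => mem_closedAlcove.2 fun c hc => (hx c hc).le

theorem inner_nonneg_of_mem_closure {x v : E} (hx : x ∈ dominantChamber b)
    (hv : v ∈ AddSubmonoid.closure (P.root '' b.support)) : 0 ≤ ⟪x, v⟫_ℝ := by
  induction hv using AddSubmonoid.closure_induction with
  | mem v hv =>
    obtain ⟨i, hi, rfl⟩ := hv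
    exact hx i hi
  | zero => simp
  | add v w _ _ hv hw =>
    rw [inner_add_right]
    exact add_nonneg hv hw

/-- The alternative $v=0$ is needed because the submonoid contains zero; it is discarded later since
roots are nonzero. -/
theorem eq_zero_or_inner_pos_of_mem_closure {x v : E} (hx : ∀ i ∈ b.support, 0 < ⟪x, P.root i⟫_ℝ)
    (hv : v ∈ AddSubmonoid.closure (P.root '' b.support)) : v = 0 ∨ 0 < ⟪x, v⟫_ℝ := by
  induction hv using AddSubmonoid.closure_induction with
  | mem v hv =>
    obtain ⟨i, hi, rfl⟩ := hv
    exact Or.inr (hx i hi)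
  | zero => simp
  | add v w _ _ hv hw =>
    rw [inner_add_right]
    rcases hv with rfl | hv <;> rcases hw with rfl | hw
    · simp
    · right; simpa using hw
    · right; simpa using hv
    · right; positivity

theorem inner_root_le_highest (hξ : IsHighestRoot b ξ) {x : E} (hx : x ∈ dominantChamber b)
    (i : ι) : ⟪x, P.root i⟫_ℝ ≤ ⟪x, P.root ξ⟫_ℝ := by
  have := inner_nonneg_of_mem_closure hx (hξ i)
  rw [inner_sub_right] at this
  linarith

theorem inner_root_lt_highest (hξ : IsHighestRoot b ξ) {x : E}
    (hx : ∀ i ∈ b.support, 0 < ⟪x, P.root i⟫_ℝ) {i : ι} (hi : i ≠ ξ) :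
    ⟪x, P.root i⟫_ℝ < ⟪x, P.root ξ⟫_ℝ := by
  rcases eq_zero_or_inner_pos_of_mem_closure hx (hξ i) with h | h
  · exact absurd (P.root.injective (sub_eq_zero.1 h)).symm hi
  · rw [inner_sub_right] at h
    linarith

theorem root_reflectionPerm_self_eq_neg (i : ι) : P.root (P.reflectionPerm i i) = -P.root i :=
  (P.root_eq_neg_iff (i := P.reflectionPerm i i) (j := i)).2 rfl

theorem inner_root_lt_one (hξ : IsHighestRoot b ξ) {x : E} (hx : x ∈ openAlcove b ξ) (i : ι) :
    ⟪x, P.root i⟫_ℝ < 1 :=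
  (inner_root_le_highest hξ (openAlcove_subset_closedAlcove hx).1 i).trans_lt (mem_openAlcove.1 hx).2

theorem neg_one_lt_inner_root (hξ : IsHighestRoot b ξ) {x : E} (hx : x ∈ openAlcove b ξ) (i : ι) :
    -1 < ⟪x, P.root i⟫_ℝ := by
  have := inner_root_lt_one hξ hx (P.reflectionPerm i i)
  rw [root_reflectionPerm_self_eq_neg, inner_neg_right] at this
  linarith

theorem inner_root_le_one (hξ : IsHighestRoot b ξ) {x : E} (hx : x ∈ closedAlcove b ξ) (i : ι) :
    ⟪x, P.root i⟫_ℝ ≤ 1 :=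
  (inner_root_le_highest hξ hx.1 i).trans hx.2

theorem inner_root_ne_zero {x : E} (hx : ∀ i ∈ b.support, 0 < ⟪x, P.root i⟫_ℝ) (i : ι) :
    ⟪x, P.root i⟫_ℝ ≠ 0 := by
  rcases b.root_mem_or_neg_mem i with h | h <;>
    rcases eq_zero_or_inner_pos_of_mem_closure hx h with h | h
  · exact absurd h (P.ne_zero i)
  · exact h.ne'
  · exact absurd (neg_eq_zero.1 h) (P.ne_zero i)
  · rw [inner_neg_right] at h
    exact (neg_pos.1 h).ne

/-- On the open alcove a root takes a nonzero value strictly between $-1$ and $1$, which is never an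
integer. -/
theorem affineForm_ne_zero (hξ : IsHighestRoot b ξ) {x : E} (hx : x ∈ openAlcove b ξ) (c : ι × ℤ) :
    affineForm P c x ≠ 0 := by
  intro h
  have h1 := inner_root_lt_one hξ hx c.1
  have h2 := neg_one_lt_inner_root hξ hx c.1
  have h3 := inner_root_ne_zero (mem_openAlcove.1 hx).1 c.1
  have h4 : ⟪x, P.root c.1⟫_ℝ = ((-c.2 : ℤ) : ℝ) := by
    unfold affineForm at h
    push_cast
    linarith
  rw [h4] at h1 h2 h3
  have h1' : -c.2 < 1 := by exact_mod_cast h1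
  have h2' : -1 < -c.2 := by exact_mod_cast h2
  exact h3 (by exact_mod_cast (by omega : -c.2 = 0))

/-- An affine root that is negative at a point of the open alcove is nonpositive on the closed
alcove. -/
theorem affineForm_nonpos_of_neg (hξ : IsHighestRoot b ξ) {x y : E} (hx : x ∈ openAlcove b ξ)
    (hy : y ∈ closedAlcove b ξ) {c : ι × ℤ} (hc : affineForm P c x < 0) :
    affineForm P c y ≤ 0 := by
  have h1 := inner_root_le_one hξ hy c.1
  have h2 := neg_one_lt_inner_root hξ hx c.1
  unfold affineForm at hc ⊢
  rcases b.root_mem_or_neg_mem c.1 with h | h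
  · have h3 := inner_nonneg_of_mem_closure (openAlcove_subset_closedAlcove hx).1 h
    have : c.2 < 0 := by exact_mod_cast (by linarith : (c.2 : ℝ) < 0)
    have : (c.2 : ℝ) ≤ -1 := by exact_mod_cast (by omega : c.2 ≤ -1)
    linarith
  · have h3 := inner_nonneg_of_mem_closure hy.1 h
    rw [inner_neg_right] at h3
    have : c.2 < 1 := by exact_mod_cast (by linarith : (c.2 : ℝ) < 1)
    have : (c.2 : ℝ) ≤ 0 := by exact_mod_cast (by omega : c.2 ≤ 0)
    linarith

end Alcove

/-! ### Words in the wall reflections and the exchange argument. -/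

section SimpleTransitivity

variable {ι E : Type*} [Finite ι] [NormedAddCommGroup E] [InnerProductSpace ℝ E]
  {P : RootPairing ι ℝ E E} [IsEuclidean P] [P.IsCrystallographic] [P.IsReduced]
  {b : P.Base} {ξ : ι}

omit [IsEuclidean P] [P.IsReduced] in
theorem inner_root_pos_of_isPos {x : E} (hx : ∀ i ∈ b.support, 0 < ⟪x, P.root i⟫_ℝ) {i : ι}
    (hi : b.IsPos i) : 0 < ⟪x, P.root i⟫_ℝ := by
  refine RootPairing.Base.IsPos.induction_on_add (p := fun i => 0 < ⟪x, P.root i⟫_ℝ) hi hx ?_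
  intro i j k hk hi hj
  rw [hk, inner_add_right]
  exact add_pos hi (hx j hj)

omit [IsEuclidean P] [P.IsReduced] in
theorem isPos_iff_inner_root_pos {x : E} (hx : ∀ i ∈ b.support, 0 < ⟪x, P.root i⟫_ℝ) {i : ι} :
    b.IsPos i ↔ 0 < ⟪x, P.root i⟫_ℝ := by
  refine ⟨inner_root_pos_of_isPos hx, fun h => ?_⟩
  rcases RootPairing.Base.IsPos.or_neg b i with hi | hi
  · exact hi
  · have := inner_root_pos_of_isPos hx hi
    change 0 < ⟪x, P.root (P.reflectionPerm i i)⟫_ℝ at this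
    rw [root_reflectionPerm_self_eq_neg, inner_neg_right] at this
    linarith

/-- The hyperplane of a simple root is the only one separating the open alcove from its mirror
image. -/
theorem affineReflection_eq_of_sign_change_simple (hξ : IsHighestRoot b ξ) {x : E}
    (hx : x ∈ openAlcove b ξ) {j : ι} (hj : j ∈ b.support) {c : ι × ℤ}
    (h1 : affineForm P c x < 0) (h2 : 0 < affineForm P c (affineReflection P (j, 0) x)) :
    affineReflection P c = affineReflection P (j, 0) := by
  obtain ⟨β, k⟩ := c
  have hx' := (mem_openAlcove.1 hx).1
  have e : affineForm P (β, k) (affineReflection P (j, 0) x) =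
      ⟪x, P.root (P.reflectionPerm j β)⟫_ℝ + k := by
    simp [affineReflection_eq, affineForm, inner_reflection_left]
  rw [e] at h2
  simp only [affineForm] at h1
  have b1 := neg_one_lt_inner_root hξ hx β
  have b2 := inner_root_lt_one hξ hx (P.reflectionPerm j β)
  have k0 : k = 0 := by
    have : k < 1 := by exact_mod_cast (by linarith : (k : ℝ) < 1)
    have : -1 < k := by exact_mod_cast (by linarith : (-1 : ℝ) < k)
    omega
  subst k0
  simp only [Int.cast_zero, add_zero] at h1 h2
  -- With $k=0$ the root $-\beta$ is positive and is made negative by $r_j$. In a reduced system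
  -- $r_j$ permutes the positive roots other than $\alpha_j$, so $-\beta=\alpha_j$.
  by_cases hβ : P.reflectionPerm β β = j
  · have : β = P.reflectionPerm j j := by
      rw [← P.root_eq_neg_iff, ← hβ, root_reflectionPerm_self_eq_neg, neg_neg]
    rw [this]
    exact affineReflection_eq_of_neg P j 0
  · have hp : b.IsPos (P.reflectionPerm β β) := by
      rw [isPos_iff_inner_root_pos hx', root_reflectionPerm_self_eq_neg, inner_neg_right]
      linarith
    have := inner_root_pos_of_isPos hx' (hp.reflectionPerm hj hβ)
    rw [P.root_reflectionPerm, root_reflectionPerm_self_eq_neg, map_neg,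
      ← P.root_reflectionPerm, inner_neg_right] at this
    linarith

omit [P.IsReduced] [IsEuclidean P] [Finite ι] in
/-- A positive root other than the highest root has Cartan number `0` or `1` with it. -/
theorem pairing_highest_of_pos (hξ : IsHighestRoot b ξ) {x : E}
    (hx : ∀ i ∈ b.support, 0 < ⟪x, P.root i⟫_ℝ) {β : ι} (hβ : 0 < ⟪x, P.root β⟫_ℝ) (hne : β ≠ ξ) :
    P.pairing β ξ = 0 ∨ P.pairing β ξ = 1 := by
  obtain ⟨n, hn⟩ := exists_pairing_eq_int P β ξ
  have hD : x ∈ dominantChamber b := fun i hi => (hx i hi).le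
  have hξ0 : 0 < ⟪x, P.root ξ⟫_ℝ := hβ.trans_le (inner_root_le_highest hξ hD β)
  have e : ⟪x, P.root (P.reflectionPerm ξ β)⟫_ℝ = ⟪x, P.root β⟫_ℝ - n * ⟪x, P.root ξ⟫_ℝ := by
    rw [P.root_reflectionPerm, P.reflection_apply_root, hn, inner_sub_right, inner_smul_right]
  have l1 := inner_root_le_highest hξ hD (P.reflectionPerm ξ β)
  have l3 := inner_root_le_highest hξ hD
    (P.reflectionPerm (P.reflectionPerm ξ β) (P.reflectionPerm ξ β))
  have l4 := inner_root_lt_highest hξ hx hne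
  rw [root_reflectionPerm_self_eq_neg, inner_neg_right, e] at l3
  rw [e] at l1
  rw [hn]
  -- The root $r_\xi\beta$ takes at $x$ the value $\langle x,\beta\rangle-n\langle x,\xi\rangle$, of
  -- absolute value at most $\langle x,\xi\rangle$. Since $0<\langle x,\beta\rangle<\langle
  -- x,\xi\rangle$, both $n\le-1$ and $n\ge2$ violate this.
  have n0 : 0 ≤ n := by
    by_contra! hneg
    have : (n : ℝ) ≤ -1 := by exact_mod_cast (by omega : n ≤ -1)
    nlinarith
  have n2 : n < 2 := by
    by_contra! hge
    have : (2 : ℝ) ≤ n := by exact_mod_cast hge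
    nlinarith
  have : n = 0 ∨ n = 1 := by omega
  rcases this with rfl | rfl <;> simp

omit [P.IsReduced] [Finite ι] in
/-- The hyperplane `⟨x, ξ⟩ = 1` is the only one separating the open alcove from its mirror image
in this hyperplane. -/
theorem affineReflection_eq_of_sign_change_highest (hξ : IsHighestRoot b ξ) {x : E}
    (hx : x ∈ openAlcove b ξ) {c : ι × ℤ}
    (h1 : affineForm P c x < 0) (h2 : 0 < affineForm P c (affineReflection P (ξ, -1) x)) :
    affineReflection P c = affineReflection P (ξ, -1) := by
  obtain ⟨β, k⟩ := c
  have hx' := (mem_openAlcove.1 hx).1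
  have no_int : ∀ m : ℤ, ∀ s t : ℝ, (m : ℝ) < s → t < m + 1 → s < -k → (-k : ℝ) < t → False := by
    intro m s t hs ht h3 h4
    have : m < -k := by exact_mod_cast hs.trans h3
    have : -k < m + 1 := by exact_mod_cast h4.trans ht
    omega
  have e : affineForm P (β, k) (affineReflection P (ξ, -1) x) =
      ⟪x, P.root β⟫_ℝ + k + (1 - ⟪x, P.root ξ⟫_ℝ) * P.pairing β ξ := by
    rw [affineReflection_apply, affineForm_sub_smul_coroot]
    simp only [affineForm]
    push_cast
    ring
  rw [e] at h2
  simp only [affineForm] at h1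
  have hξ1 := (mem_openAlcove.1 hx).2
  have b1 := neg_one_lt_inner_root hξ hx β
  have b2 := inner_root_lt_one hξ hx β
  have hξ0 : 0 ≤ ⟪x, P.root ξ⟫_ℝ := by
    have h3 := inner_root_le_highest hξ (openAlcove_subset_closedAlcove hx).1 β
    have h4 := inner_root_le_highest hξ (openAlcove_subset_closedAlcove hx).1 (P.reflectionPerm β β)
    rw [root_reflectionPerm_self_eq_neg, inner_neg_right] at h4
    linarith
  by_cases hβξ : β = ξ
  · subst hβξ
    rw [P.pairing_same] at h2
    have k1 : k = -1 := by
      have : -2 < k := by exact_mod_cast (by linarith : (-2 : ℝ) < k)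
      have : k < 0 := by exact_mod_cast (by linarith : (k : ℝ) < 0)
      omega
    rw [k1]
  exfalso
  by_cases hβξ' : P.reflectionPerm β β = ξ
  · have h3 : β = P.reflectionPerm ξ ξ := by
      rw [← P.root_eq_neg_iff, ← hβξ', root_reflectionPerm_self_eq_neg, neg_neg]
    have h4 : P.pairing β ξ = -2 := by rw [h3, P.pairing_reflectionPerm_self_left, P.pairing_same]
    rw [h4] at h2
    rw [h3, root_reflectionPerm_self_eq_neg, inner_neg_right] at h1 h2
    linarith
  rcases lt_or_gt_of_ne (inner_root_ne_zero hx' β) with hneg | hpos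
  · have h3 : P.pairing β ξ = 0 ∨ P.pairing β ξ = -1 := by
      have := pairing_highest_of_pos hξ hx' (β := P.reflectionPerm β β)
        (by rw [root_reflectionPerm_self_eq_neg, inner_neg_right]; linarith) hβξ'
      rw [P.pairing_reflectionPerm_self_left] at this
      rcases this with h | h
      · left; linarith
      · right; linarith
    have h4 := inner_root_le_highest hξ (openAlcove_subset_closedAlcove hx).1 (P.reflectionPerm β β)
    rw [root_reflectionPerm_self_eq_neg, inner_neg_right] at h4
    rcases h3 with h3 | h3 <;> rw [h3] at h2
    · linarith
    · linarith
  · have h4 := inner_root_le_highest hξ (openAlcove_subset_closedAlcove hx).1 β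
    rcases pairing_highest_of_pos hξ hx' hpos hβξ with h3 | h3 <;> rw [h3] at h2
    · linarith
    -- With Cartan number $1$, the values of $\beta$ before and after the reflection both lie in
    -- $(0,1)$, as $\langle x,\beta\rangle<\langle x,\xi\rangle$; no integer level is crossed.
    · refine no_int 0 ⟪x, P.root β⟫_ℝ (⟪x, P.root β⟫_ℝ + (1 - ⟪x, P.root ξ⟫_ℝ)) ?_ ?_ ?_ ?_
      · simpa using hpos
      · have := inner_root_lt_highest hξ hx' hβξ
        push_cast
        linarith
      · linarith
      · linarith

theorem affineReflection_eq_of_sign_change (hξ : IsHighestRoot b ξ) {x : E}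
    (hx : x ∈ openAlcove b ξ) {c d : ι × ℤ} (hd : d ∈ simpleAffineRoots b ξ)
    (h1 : affineForm P c x < 0) (h2 : 0 < affineForm P c (affineReflection P d x)) :
    affineReflection P c = affineReflection P d := by
  obtain ⟨j, k⟩ := d
  rcases hd with ⟨hj, hk⟩ | hd
  · simp only at hj hk
    subst hk
    exact affineReflection_eq_of_sign_change_simple hξ hx hj h1 h2
  · rw [Set.mem_singleton_iff.1 hd] at h2 ⊢
    have e : affineReflection P (P.reflectionPerm ξ ξ, 1) = affineReflection P (ξ, -1) := by
      simpa using affineReflection_eq_of_neg P ξ (-1)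
    rw [e] at h2 ⊢
    exact affineReflection_eq_of_sign_change_highest hξ hx h1 h2

variable (b ξ) in
/-- The reflections in the walls of the alcove. -/
def simpleAffineReflections : Set (Equiv.Perm E) := affineReflection P '' simpleAffineRoots b ξ

omit [Finite ι] [P.IsReduced] in
theorem exists_affineForm_comp_list_prod {L : List (Equiv.Perm E)}
    (hL : ∀ s ∈ L, s ∈ simpleAffineReflections b ξ) (c : ι × ℤ) :
    ∃ c' : ι × ℤ, ∀ x, affineForm P c' x = affineForm P c (L.prod x) := by
  induction L generalizing c with
  | nil => exact ⟨c, by simp⟩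
  | cons s L ih =>
    obtain ⟨d, -, rfl⟩ := hL s (by simp)
    obtain ⟨c1, hc1, -⟩ := exists_affineForm_comp_affineReflection P c d
    obtain ⟨c2, hc2⟩ := ih (fun t ht => hL t (by simp [ht])) c1
    exact ⟨c2, fun x => by rw [hc2, hc1, List.prod_cons, Equiv.Perm.mul_apply]⟩

/-- The exchange condition. -/
theorem exchange (hξ : IsHighestRoot b ξ) {x : E} (hx : x ∈ openAlcove b ξ)
    {L : List (Equiv.Perm E)} (hL : ∀ s ∈ L, s ∈ simpleAffineReflections b ξ) {c : ι × ℤ}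
    (h1 : affineForm P c x < 0) (h2 : 0 < affineForm P c (L.prod x)) :
    ∃ L' : List (Equiv.Perm E), (∀ s ∈ L', s ∈ simpleAffineReflections b ξ) ∧
      L'.length + 1 = L.length ∧ affineReflection P c * L.prod = L'.prod := by
  induction L generalizing c with
  | nil =>
    simp only [List.prod_nil, Equiv.Perm.one_apply] at h2
    linarith
  | cons s L ih =>
    obtain ⟨d, hd, rfl⟩ := hL s (by simp)
    have hL' : ∀ t ∈ L, t ∈ simpleAffineReflections b ξ := fun t ht => hL t (by simp [ht])
    obtain ⟨c', hc', hr⟩ := exists_affineForm_comp_affineReflection P c d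
    -- The sign of the pulled-back root at $x$ tells where the crossing occurs: if negative, in the
    -- tail, to which induction applies; if positive, at the first letter, which then equals the
    -- reflection in `c` and cancels.
    rcases lt_or_gt_of_ne (affineForm_ne_zero hξ hx c') with h3 | h3
    · rw [List.prod_cons, Equiv.Perm.mul_apply, ← hc'] at h2
      obtain ⟨L', hL'1, hL'2, hL'3⟩ := ih hL' h3 h2
      refine ⟨affineReflection P d :: L', ?_, by simp [hL'2], ?_⟩
      · intro t ht
        rcases List.mem_cons.1 ht with rfl | ht
        · exact ⟨d, hd, rfl⟩
        · exact hL'1 t ht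
      · rw [List.prod_cons, List.prod_cons, ← hL'3, hr]
        simp only [← mul_assoc]
        rw [affineReflection_mul_self, one_mul]
    · rw [hc'] at h3
      refine ⟨L, hL', by simp, ?_⟩
      rw [affineReflection_eq_of_sign_change hξ hx hd h1 h3, List.prod_cons, ← mul_assoc,
        affineReflection_mul_self, one_mul]

/-- If a word in the wall reflections starts with a letter whose wall does not separate the
alcove from its image, the word can be shortened. -/
theorem exists_shorter_word (hξ : IsHighestRoot b ξ) {x : E} (hx : x ∈ openAlcove b ξ)
    {L : List (Equiv.Perm E)} (hL : ∀ s ∈ L, s ∈ simpleAffineReflections b ξ) {d : ι × ℤ}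
    (hd : d ∈ simpleAffineRoots b ξ)
    (h : 0 < affineForm P d ((affineReflection P d * L.prod) x)) :
    ∃ L' : List (Equiv.Perm E), (∀ s ∈ L', s ∈ simpleAffineReflections b ξ) ∧
      L'.length + 1 = L.length ∧ affineReflection P d * L.prod = L'.prod := by
  obtain ⟨c, hc, hr⟩ := exists_affineForm_comp_affineReflection P d d
  rw [affineReflection_mul_self, one_mul] at hr
  have h1 : affineForm P c x < 0 := by
    rw [hc, affineForm_affineReflection_self]
    have := hx d hd
    linarith
  rw [Equiv.Perm.mul_apply, ← hc] at h
  rw [← hr]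
  exact exchange hξ hx hL h1 h

/-- When both endpoints lie in the open alcove, the wall of the first letter does not separate them,
so every nonempty word can be shortened. -/
theorem list_prod_eq_one_of_mem_openAlcove (hξ : IsHighestRoot b ξ) {x : E}
    (hx : x ∈ openAlcove b ξ) {L : List (Equiv.Perm E)}
    (hL : ∀ s ∈ L, s ∈ simpleAffineReflections b ξ) (h : L.prod x ∈ openAlcove b ξ) :
    L.prod = 1 := by
  induction hn : L.length using Nat.strong_induction_on generalizing L with
  | _ n ih =>
    match L with
    | [] => rfl
    | s :: L =>
      obtain ⟨d, hd, rfl⟩ := hL s (by simp)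
      rw [List.prod_cons] at h ⊢
      obtain ⟨L', h1, h2, h3⟩ := exists_shorter_word hξ hx
        (fun t ht => hL t (by simp [ht])) hd (h d hd)
      rw [h3] at h ⊢
      refine ih L'.length ?_ h1 h rfl
      rw [← hn, List.length_cons]
      omega

/-- Points of the closed alcove may lie on walls, so the sides are read off at the interior point
$x_0$. If the first wall separates the image of $x_0$ from the alcove, it must contain $y$ and the
first letter can be dropped; otherwise the word shortens. -/
theorem eq_of_list_prod_apply_eq (hξ : IsHighestRoot b ξ) {x₀ : E} (hx₀ : x₀ ∈ openAlcove b ξ)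
    {x y : E} (hx : x ∈ closedAlcove b ξ) (hy : y ∈ closedAlcove b ξ) {L : List (Equiv.Perm E)}
    (hL : ∀ s ∈ L, s ∈ simpleAffineReflections b ξ) (h : L.prod x = y) : x = y := by
  induction hn : L.length using Nat.strong_induction_on generalizing L with
  | _ n ih =>
    match L with
    | [] => simpa using h
    | s :: L =>
      have hL' : ∀ t ∈ L, t ∈ simpleAffineReflections b ξ := fun t ht => hL t (by simp [ht])
      obtain ⟨d, hd, rfl⟩ := hL s (by simp)
      obtain ⟨c, hc⟩ := exists_affineForm_comp_list_prod hL d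
      rw [List.prod_cons] at h hc
      rw [List.length_cons] at hn
      rcases lt_or_gt_of_ne (affineForm_ne_zero hξ hx₀ c) with h1 | h1
      · have h2 := affineForm_nonpos_of_neg hξ hx₀ hx h1
        rw [hc, h] at h2
        have h3 : affineForm P d y = 0 := le_antisymm h2 (mem_closedAlcove.1 hy d hd)
        refine ih L.length (by omega) hL' ?_ rfl
        have h4 : affineReflection P d y = y := by simp [affineReflection_apply, h3]
        rw [← h, ← Equiv.Perm.mul_apply, ← mul_assoc, affineReflection_mul_self, one_mul] at h4
        rw [h4, h]
      · rw [hc] at h1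
        obtain ⟨L', h2, h3, h4⟩ := exists_shorter_word hξ hx₀ hL' hd h1
        rw [h4] at h
        exact ih L'.length (by omega) h2 h rfl

end SimpleTransitivity

/-! ### The wall reflections generate all affine reflections. -/

section Generation

variable {ι E : Type*} [Finite ι] [NormedAddCommGroup E] [InnerProductSpace ℝ E]
  {P : RootPairing ι ℝ E E} [IsEuclidean P] [P.IsCrystallographic] [P.IsReduced]
  {b : P.Base} {ξ : ι}

omit [Finite ι] [IsEuclidean P] [P.IsCrystallographic] [P.IsReduced] in
theorem inner_root_self_pos (i : ι) : 0 < ⟪P.root i, P.root i⟫_ℝ :=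
  real_inner_self_pos.2 (P.ne_zero i)

omit [Finite ι] [P.IsCrystallographic] [P.IsReduced] in
theorem pairing_eq_mul_inner (i j : ι) :
    P.pairing i j = 2 / ⟪P.root j, P.root j⟫_ℝ * ⟪P.root i, P.root j⟫_ℝ := by
  rw [← inner_root_coroot, IsEuclidean.coroot_eq (P := P), inner_smul_right]

omit [Finite ι] [P.IsCrystallographic] [P.IsReduced] in
theorem pairing_pos_iff (i j : ι) : 0 < P.pairing i j ↔ 0 < ⟪P.root i, P.root j⟫_ℝ := by
  rw [pairing_eq_mul_inner]
  exact mul_pos_iff_of_pos_left (div_pos two_pos (inner_root_self_pos j))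

omit [Finite ι] [P.IsCrystallographic] [P.IsReduced] in
-- Otherwise $-\beta$ is dominant and $\langle\beta,\xi\rangle\ge0$; bounding the root $-\beta$ by
-- $\xi$ at the point $-\beta$ gives $\langle\beta,\beta\rangle\le-\langle\beta,\xi\rangle\le0$.
theorem exists_simple_pairing_pos (hξ : IsHighestRoot b ξ) (β : ι) :
    ∃ d ∈ simpleAffineRoots b ξ, 0 < P.pairing β d.1 := by
  by_contra! h
  have h' : ∀ d ∈ simpleAffineRoots b ξ, ⟪P.root β, P.root d.1⟫_ℝ ≤ 0 := by
    intro d hd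
    rw [← not_lt, ← pairing_pos_iff, not_lt]
    exact h d hd
  have hdom : -P.root β ∈ dominantChamber b := by
    intro i hi
    rw [inner_neg_left]
    have := h' (i, 0) (Or.inl ⟨hi, rfl⟩)
    linarith
  have h1 := inner_root_le_highest hξ hdom (P.reflectionPerm β β)
  have h2 := h' (P.reflectionPerm ξ ξ, 1) (Or.inr rfl)
  simp only [root_reflectionPerm_self_eq_neg, inner_neg_left, inner_neg_right, neg_neg] at h1 h2
  have := inner_root_self_pos (P := P) β
  linarith

/-- Descent on the value at $x$: a counterexample of least positive value is reflected in a wall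
with which it has positive Cartan number. The value drops, so the new affine root is either
negative, whence the hyperplane was that wall, or a smaller counterexample. -/
theorem affineReflection_mem_closure_of_pos (hξ : IsHighestRoot b ξ) {x : E}
    (hx : x ∈ openAlcove b ξ) {c : ι × ℤ} (hc : 0 < affineForm P c x) :
    affineReflection P c ∈ Subgroup.closure (simpleAffineReflections b ξ) := by
  by_contra hbad
  let T : Set (ι × ℤ) := {d | (0 < affineForm P d x ∧
    affineReflection P d ∉ Subgroup.closure (simpleAffineReflections b ξ)) ∧
    affineForm P d x ≤ affineForm P c x}
  -- There are finitely many roots, and all take values in $(-1,1)$ at $x$, so bounding the affine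
  -- root bounds its constant term.
  have hfin : T.Finite := by
    refine ((Set.finite_univ (α := ι)).prod
      (Set.finite_Icc (-1 : ℤ) (⌈affineForm P c x + 1⌉))).subset ?_
    rintro ⟨i, k⟩ ⟨⟨h1, -⟩, h2⟩
    refine ⟨trivial, ?_, ?_⟩
    · have h3 := inner_root_lt_one hξ hx i
      simp only [affineForm] at h1
      have : (-1 : ℝ) < k := by linarith
      exact (by exact_mod_cast this : (-1 : ℤ) < k).le
    · have h3 := neg_one_lt_inner_root hξ hx i
      simp only [affineForm] at h2 ⊢
      have : (k : ℝ) ≤ ⟪x, P.root c.1⟫_ℝ + c.2 + 1 := by linarith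
      exact_mod_cast this.trans (Int.le_ceil _)
  obtain ⟨m, ⟨⟨hm1, hm2⟩, hm3⟩, hmin⟩ :=
    Set.exists_min_image T (fun d => affineForm P d x) hfin ⟨c, ⟨hc, hbad⟩, le_rfl⟩
  obtain ⟨d, hd, hpos⟩ := exists_simple_pairing_pos hξ m.1
  have hdS : affineReflection P d ∈ Subgroup.closure (simpleAffineReflections b ξ) :=
    Subgroup.subset_closure ⟨d, hd, rfl⟩
  obtain ⟨m', hm', hr⟩ := exists_affineForm_comp_affineReflection P m d
  have hlt : affineForm P m' x < affineForm P m x := by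
    rw [hm', affineReflection_apply, affineForm_sub_smul_coroot]
    have := mul_pos (hx d hd) hpos
    linarith
  have hr' : affineReflection P m =
      affineReflection P d * affineReflection P m' * affineReflection P d := by
    rw [hr]
    simp only [← mul_assoc, affineReflection_mul_self, one_mul]
    rw [mul_assoc, affineReflection_mul_self, mul_one]
  rcases lt_or_gt_of_ne (affineForm_ne_zero hξ hx m') with h | h
  · apply hm2
    have hneg : ∀ y, affineForm P (P.reflectionPerm m.1 m.1, -m.2) y = -affineForm P m y := by
      intro y
      simp only [affineForm, root_reflectionPerm_self_eq_neg, inner_neg_right, Int.cast_neg]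
      ring
    rw [← affineReflection_eq_of_neg P m.1 m.2,
      affineReflection_eq_of_sign_change hξ hx hd (by rw [hneg]; linarith)
        (by rw [hneg, ← hm']; linarith)]
    exact hdS
  · have hm'S : affineReflection P m' ∉ Subgroup.closure (simpleAffineReflections b ξ) := by
      intro hm'S
      apply hm2
      rw [hr']
      exact mul_mem (mul_mem hdS hm'S) hdS
    exact absurd (hmin m' ⟨⟨h, hm'S⟩, hlt.le.trans hm3⟩) (not_le.2 hlt)

/-- The affine reflections are generated by the reflections in the walls of the alcove. -/
theorem affineReflection_mem_closure (hξ : IsHighestRoot b ξ) {x : E}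
    (hx : x ∈ openAlcove b ξ) (c : ι × ℤ) :
    affineReflection P c ∈ Subgroup.closure (simpleAffineReflections b ξ) := by
  rcases lt_or_gt_of_ne (affineForm_ne_zero hξ hx c) with h | h
  · rw [← affineReflection_eq_of_neg P c.1 c.2]
    refine affineReflection_mem_closure_of_pos hξ hx ?_
    simp only [affineForm, root_reflectionPerm_self_eq_neg, inner_neg_right, Int.cast_neg] at h ⊢
    linarith
  · exact affineReflection_mem_closure_of_pos hξ hx h

omit [Finite ι] [P.IsCrystallographic] [P.IsReduced] in
theorem exists_list_prod_eq_of_mem_closure {g : Equiv.Perm E}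
    (hg : g ∈ Subgroup.closure (simpleAffineReflections b ξ)) :
    ∃ L : List (Equiv.Perm E), (∀ s ∈ L, s ∈ simpleAffineReflections b ξ) ∧ L.prod = g := by
  have key : ∀ s ∈ simpleAffineReflections b ξ, ∀ g : Equiv.Perm E,
      (∃ L : List (Equiv.Perm E), (∀ s ∈ L, s ∈ simpleAffineReflections b ξ) ∧ L.prod = g) →
      ∃ L : List (Equiv.Perm E), (∀ s ∈ L, s ∈ simpleAffineReflections b ξ) ∧ L.prod = s * g := by
    rintro s hs g ⟨L, hL, rfl⟩
    exact ⟨s :: L, List.forall_mem_cons.2 ⟨hs, hL⟩, List.prod_cons⟩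
  induction hg using Subgroup.closure_induction_left with
  | one => exact ⟨[], by simp⟩
  | mul_left s hs g _ ih => exact key s hs g ih
  | inv_mul_cancel s hs g _ ih =>
    obtain ⟨d, hd, rfl⟩ := hs
    rw [affineReflection_inv]
    exact key _ ⟨d, hd, rfl⟩ g ih

end Generation

/-! ### The affine Weyl group and uniqueness of representatives. -/

section WeylGroup

variable {ι E : Type*} [NormedAddCommGroup E] [InnerProductSpace ℝ E]

/-- The Weyl group, regarded as a group of linear transformations of `E`. -/
noncomputable def linearWeyl (P : RootPairing ι ℝ E E) : Subgroup (E ≃ₗ[ℝ] E) :=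
  P.weylGroup.map (RootPairing.Equiv.weightHom P)

variable {P : RootPairing ι ℝ E E}

theorem linearWeyl_eq_closure : linearWeyl P = Subgroup.closure (Set.range P.reflection) := by
  rw [← RootPairing.range_weylGroup_weightHom, MonoidHom.domRestrict_range]
  rfl

theorem reflection_mem_linearWeyl (i : ι) : P.reflection i ∈ linearWeyl P := by
  rw [linearWeyl_eq_closure]
  exact Subgroup.subset_closure ⟨i, rfl⟩

theorem linearWeyl_induction {p : (E ≃ₗ[ℝ] E) → Prop} (one : p 1)
    (mul : ∀ i w, w ∈ linearWeyl P → p w → p (P.reflection i * w)) {w : E ≃ₗ[ℝ] E}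
    (hw : w ∈ linearWeyl P) : p w := by
  rw [linearWeyl_eq_closure] at hw mul
  induction hw using Subgroup.closure_induction_left with
  | one => exact one
  | mul_left s hs w hw ih =>
    obtain ⟨i, rfl⟩ := hs
    exact mul i w hw ih
  | inv_mul_cancel s hs w hw ih =>
    obtain ⟨i, rfl⟩ := hs
    rw [P.reflection_inv]
    exact mul i w hw ih

theorem finite_linearWeyl [Finite ι] (P : RootPairing ι ℝ E E) [P.IsRootSystem] :
    Finite (linearWeyl P) := by
  have hroot : ∀ w ∈ linearWeyl P, ∀ i, ∃ j, w (P.root i) = P.root j := by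
    intro w hw
    refine linearWeyl_induction (P := P) (p := fun w => ∀ i, ∃ j, w (P.root i) = P.root j)
      (fun i => ⟨i, rfl⟩) ?_ hw
    intro k w _ ih i
    obtain ⟨j, hj⟩ := ih i
    exact ⟨P.reflectionPerm k j, by rw [LinearEquiv.mul_apply, hj, P.root_reflectionPerm]⟩
  choose f hf using hroot
  refine Finite.of_injective (fun w : linearWeyl P => f w.1 w.2) ?_
  intro w w' h
  apply Subtype.ext
  apply LinearEquiv.toLinearMap_injective
  apply LinearMap.ext_on (RootPairing.IsRootSystem.span_root_eq_top (P := P))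
  rintro _ ⟨i, rfl⟩
  exact (hf w.1 w.2 i).trans ((congrArg P.root (congrFun h i)).trans (hf w'.1 w'.2 i).symm)

theorem inner_linearWeyl [IsEuclidean P] {w : E ≃ₗ[ℝ] E} (hw : w ∈ linearWeyl P) (x y : E) :
    ⟪w x, w y⟫_ℝ = ⟪x, y⟫_ℝ := by
  refine linearWeyl_induction (P := P) (p := fun w => ⟪w x, w y⟫_ℝ = ⟪x, y⟫_ℝ) rfl ?_ hw
  intro i w _ ih
  rw [LinearEquiv.mul_apply, LinearEquiv.mul_apply, inner_reflection_reflection, ih]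

variable [P.IsRootSystem] (b : P.Base)

/-- The coroot lattice. -/
noncomputable def corootLattice : Submodule ℤ E :=
  Submodule.span ℤ (Set.range b.toCoweightBasis)

theorem corootLattice_eq : corootLattice b = Submodule.span ℤ (P.coroot '' b.support) := by
  rw [corootLattice]
  congr 1
  ext x
  simp

theorem coroot_mem_corootLattice (i : ι) : P.coroot i ∈ corootLattice b := by
  rw [corootLattice_eq]
  exact b.coroot_mem_span_int i

variable {b}

theorem linearWeyl_apply_mem_corootLattice [IsEuclidean P] {w : E ≃ₗ[ℝ] E} (hw : w ∈ linearWeyl P)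
    {q : E} (hq : q ∈ corootLattice b) : w q ∈ corootLattice b := by
  refine linearWeyl_induction (P := P) (p := fun w => w q ∈ corootLattice b) hq ?_ hw
  intro i w _ ih
  rw [LinearEquiv.mul_apply]
  generalize w q = r at ih
  rw [corootLattice_eq] at ih
  induction ih using Submodule.span_induction with
  | mem x hx =>
    obtain ⟨j, -, rfl⟩ := hx
    rw [reflection_coroot]
    exact coroot_mem_corootLattice b _
  | zero => simp
  | add x y _ _ hx hy =>
    rw [map_add]
    exact add_mem hx hy
  | smul n x _ hx =>
    rw [map_zsmul]
    exact (corootLattice b).smul_mem n hx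

/-- The affine transformation `x ↦ w x + q`. -/
def affineMotion (w : E ≃ₗ[ℝ] E) (q : E) : Equiv.Perm E := w.toEquiv.trans (Equiv.addRight q)

omit [P.IsRootSystem] in
theorem affineMotion_apply (w : E ≃ₗ[ℝ] E) (q x : E) : affineMotion w q x = w x + q := rfl

omit [P.IsRootSystem] in
theorem affineMotion_one_zero : affineMotion (1 : E ≃ₗ[ℝ] E) 0 = 1 := by
  ext x
  simp [affineMotion_apply]

variable [Finite ι] [IsEuclidean P] [P.IsCrystallographic] [P.IsReduced] {ξ : ι}

theorem affineMotion_mem_closure (hξ : IsHighestRoot b ξ) {x : E} (hx : x ∈ openAlcove b ξ)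
    {w : E ≃ₗ[ℝ] E} (hw : w ∈ linearWeyl P) {q : E} (hq : q ∈ corootLattice b) :
    affineMotion w q ∈ Subgroup.closure (simpleAffineReflections b ξ) := by
  have h1 : affineMotion w 0 ∈ Subgroup.closure (simpleAffineReflections b ξ) := by
    refine linearWeyl_induction (P := P) (p := fun w => affineMotion w 0 ∈
      Subgroup.closure (simpleAffineReflections b ξ)) ?_ ?_ hw
    · rw [affineMotion_one_zero]
      exact one_mem _
    · intro i w _ ih
      convert mul_mem (affineReflection_mem_closure hξ hx (i, 0)) ih
      ext x
      simp [affineMotion_apply, affineReflection_eq]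
  have h2 : affineMotion 1 q ∈ Subgroup.closure (simpleAffineReflections b ξ) := by
    rw [corootLattice_eq] at hq
    induction hq using Submodule.span_induction with
    | mem q hq =>
      obtain ⟨i, -, rfl⟩ := hq
      -- Translation by a coroot is the product of the reflections in two adjacent parallel
      -- hyperplanes.
      convert mul_mem (affineReflection_mem_closure hξ hx (i, -1))
        (affineReflection_mem_closure hξ hx (i, 0))
      ext x
      simp [affineMotion_apply, affineReflection_eq]
    | zero =>
      rw [affineMotion_one_zero]
      exact one_mem _
    | add q r _ _ hq hr =>
      convert mul_mem hq hr
      ext x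
      simp [affineMotion_apply]
      abel
    | smul n q _ hq =>
      convert zpow_mem hq n
      have key : ∀ m : ℤ, affineMotion 1 q ^ m = affineMotion 1 (m • q) := by
        have hnat : ∀ m : ℕ, affineMotion 1 q ^ m = affineMotion 1 (m • q) := by
          intro m
          induction m with
          | zero => ext x; simp [affineMotion_apply]
          | succ m ih =>
            rw [pow_succ, ih]
            ext x
            simp [affineMotion_apply, add_smul]
            abel
        intro m
        obtain ⟨m, rfl | rfl⟩ := m.eq_nat_or_neg
        · rw [zpow_natCast, hnat, natCast_zsmul]
        · rw [zpow_neg, zpow_natCast, hnat, inv_eq_iff_mul_eq_one]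
          ext x
          simp [affineMotion_apply]
      exact (key n).symm
  convert mul_mem h2 h1
  ext x
  simp [affineMotion_apply]

/-- The affine Weyl group acts freely on the interior of the alcove. -/
theorem eq_one_of_mem_openAlcove (hξ : IsHighestRoot b ξ) {x : E} (hx : x ∈ openAlcove b ξ)
    {w : E ≃ₗ[ℝ] E} (hw : w ∈ linearWeyl P) {q : E} (hq : q ∈ corootLattice b)
    (h : w x + q ∈ openAlcove b ξ) : w = 1 ∧ q = 0 := by
  obtain ⟨L, hL, hLw⟩ := exists_list_prod_eq_of_mem_closure (affineMotion_mem_closure hξ hx hw hq)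
  have h1 : affineMotion w q = 1 := by
    rw [← hLw]
    refine list_prod_eq_one_of_mem_openAlcove hξ hx hL ?_
    rw [hLw]
    exact h
  have h2 : ∀ y, w y + q = y := fun y => by rw [← affineMotion_apply, h1]; rfl
  have h3 : q = 0 := by simpa using h2 0
  refine ⟨LinearEquiv.ext fun y => ?_, h3⟩
  simpa [h3] using h2 y

theorem eq_of_mem_closedAlcove (hξ : IsHighestRoot b ξ) {x₀ : E} (hx₀ : x₀ ∈ openAlcove b ξ)
    {x y : E} (hx : x ∈ closedAlcove b ξ) (hy : y ∈ closedAlcove b ξ)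
    {w : E ≃ₗ[ℝ] E} (hw : w ∈ linearWeyl P) {q : E} (hq : q ∈ corootLattice b)
    (h : w x + q = y) : x = y := by
  obtain ⟨L, hL, hLw⟩ := exists_list_prod_eq_of_mem_closure (affineMotion_mem_closure hξ hx₀ hw hq)
  exact eq_of_list_prod_apply_eq hξ hx₀ hx hy hL (by rw [hLw]; exact h)

omit [Finite ι] [P.IsRootSystem] [IsEuclidean P] [P.IsCrystallographic] [P.IsReduced] in
theorem exists_pos_smul_lt_one (x y v : E) : ∃ t : ℝ, 0 < t ∧ ⟪t • x, v⟫_ℝ < 1 ∧ ⟪t • y, v⟫_ℝ < 1 := by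
  have h : 0 < 1 + |⟪x, v⟫_ℝ| + |⟪y, v⟫_ℝ| := by positivity
  refine ⟨(1 + |⟪x, v⟫_ℝ| + |⟪y, v⟫_ℝ|)⁻¹, inv_pos.2 h, ?_, ?_⟩ <;>
  · simp only [inner_smul_left, RCLike.conj_to_real]
    rw [inv_mul_lt_one₀ h]
    have := le_abs_self ⟪x, v⟫_ℝ
    have := le_abs_self ⟪y, v⟫_ℝ
    have := abs_nonneg ⟪x, v⟫_ℝ
    have := abs_nonneg ⟪y, v⟫_ℝ
    linarith

/-- The closed Weyl chamber meets every orbit of the Weyl group in at most one point. -/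
theorem eq_of_mem_dominantChamber (hξ : IsHighestRoot b ξ) {x₀ : E} (hx₀ : x₀ ∈ openAlcove b ξ)
    {x : E} (hx : x ∈ dominantChamber b) {w : E ≃ₗ[ℝ] E} (hw : w ∈ linearWeyl P)
    (hy : w x ∈ dominantChamber b) : w x = x := by
  obtain ⟨t, ht, h1, h2⟩ := exists_pos_smul_lt_one x (w x) (P.root ξ)
  have hcone : ∀ z ∈ dominantChamber b, t • z ∈ dominantChamber b := by
    intro z hz i hi
    rw [inner_smul_left]
    exact mul_nonneg ht.le (hz i hi)
  have := eq_of_mem_closedAlcove hξ hx₀ ⟨hcone _ hx, h1.le⟩ ⟨hcone _ hy, h2.le⟩ hw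
    (zero_mem (corootLattice b)) (by rw [add_zero, map_smul])
  exact (smul_right_injective E ht.ne' this).symm

/-- The Weyl group acts freely on the interior of the Weyl chamber. -/
theorem eq_one_of_strictly_dominant (hξ : IsHighestRoot b ξ) {x : E}
    (hx : ∀ i ∈ b.support, 0 < ⟪x, P.root i⟫_ℝ) {w : E ≃ₗ[ℝ] E} (hw : w ∈ linearWeyl P)
    (hy : w x ∈ dominantChamber b) : w = 1 := by
  obtain ⟨t, ht, h1, -⟩ := exists_pos_smul_lt_one x x (P.root ξ)
  have hA : t • x ∈ openAlcove b ξ := by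
    refine mem_openAlcove.2 ⟨fun i hi => ?_, h1⟩
    rw [inner_smul_left]
    exact mul_pos ht (hx i hi)
  have hwx := eq_of_mem_dominantChamber hξ hA (fun i hi => (hx i hi).le) hw hy
  refine (eq_one_of_mem_openAlcove hξ hA hw (zero_mem (corootLattice b)) ?_).1
  rwa [add_zero, map_smul, hwx]

end WeylGroup

/-! ### Every affine orbit meets the closed alcove. -/

section Covering

variable {ι E : Type*} [Finite ι] [NormedAddCommGroup E] [InnerProductSpace ℝ E]
  [FiniteDimensional ℝ E] {P : RootPairing ι ℝ E E} [P.IsRootSystem] {b : P.Base} {ξ : ι}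

omit [Finite ι] in
variable (b ξ) in
theorem openAlcove_nonempty : (openAlcove b ξ).Nonempty := by
  -- The vector dual to this functional has inner product $1$ with each simple root; shrinking it
  -- also satisfies the bound on $\xi$.
  let f : E →ₗ[ℝ] ℝ := b.toWeightBasis.constr ℝ fun _ => (1 : ℝ)
  let x := (InnerProductSpace.toDual ℝ E).symm (LinearMap.toContinuousLinearMap f)
  have hx : ∀ i ∈ b.support, ⟪x, P.root i⟫_ℝ = 1 := by
    intro i hi
    have h1 : ⟪x, P.root i⟫_ℝ = f (P.root i) := by
      simp [x, InnerProductSpace.toDual_symm_apply]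
    rw [h1, ← b.toWeightBasis_apply ⟨i, hi⟩, Module.Basis.constr_basis]
  obtain ⟨t, ht, h1, -⟩ := exists_pos_smul_lt_one x x (P.root ξ)
  refine ⟨t • x, mem_openAlcove.2 ⟨fun i hi => ?_, h1⟩⟩
  rw [inner_smul_left, hx i hi]
  simpa using ht

variable [IsEuclidean P]

omit [Finite ι] [FiniteDimensional ℝ E] [P.IsRootSystem] in
-- The correction term is negative exactly when the hyperplane strictly separates $x$ and $y$;
-- reflecting $y$ then brings it closer to $x$.
theorem norm_affineReflection_sub_sq (d : ι × ℤ) (x y : E) :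
    ‖affineReflection P d y - x‖ ^ 2 = ‖y - x‖ ^ 2 +
      2 * (2 / ⟪P.root d.1, P.root d.1⟫_ℝ) * affineForm P d y * affineForm P d x := by
  have hne := (inner_root_self_pos (P := P) d.1).ne'
  have h1 : affineReflection P d y - x = (y - x) - affineForm P d y • P.coroot d.1 := by
    rw [affineReflection_apply]
    abel
  have h2 : ⟪y - x, P.root d.1⟫_ℝ = affineForm P d y - affineForm P d x := by
    simp only [affineForm, inner_sub_left]
    ring
  have h3 : ‖P.coroot d.1‖ ^ 2 = 2 * (2 / ⟪P.root d.1, P.root d.1⟫_ℝ) := by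
    rw [← real_inner_self_eq_norm_sq, IsEuclidean.coroot_eq (P := P), inner_smul_left,
      inner_smul_right]
    simp only [RCLike.conj_to_real]
    field_simp
  rw [h1, norm_sub_sq_real, norm_smul, mul_pow, h3, inner_smul_right,
    IsEuclidean.coroot_eq (P := P), inner_smul_right, h2, Real.norm_eq_abs, sq_abs]
  ring

/-- Every point is equivalent under the affine Weyl group to a point of the closed alcove. -/
theorem exists_apply_add_mem_closedAlcove (x : E) :
    ∃ w ∈ linearWeyl P, ∃ q ∈ corootLattice b, w x + q ∈ closedAlcove b ξ := by
  obtain ⟨x₀, hx₀⟩ := openAlcove_nonempty b ξ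
  have := finite_linearWeyl P
  let Y : Set E := {y | (∃ w ∈ linearWeyl P, ∃ q ∈ corootLattice b, y = w x + q) ∧
    ‖y - x₀‖ ≤ ‖x - x₀‖}
  -- Elements of $W$ are isometries, so the distance bound confines $q$ to a ball, which contains
  -- finitely many lattice points.
  have hY : Y.Finite := by
    have h1 : (Metric.closedBall (0 : E) (‖x - x₀‖ + ‖x₀‖ + ‖x‖) ∩
        (corootLattice b : Set E)).Finite := by
      have := ZSpan.setFinite_inter b.toCoweightBasis
        (Metric.isBounded_closedBall (x := (0 : E)) (r := ‖x - x₀‖ + ‖x₀‖ + ‖x‖))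
      exact this
    refine ((Set.toFinite (linearWeyl P : Set (E ≃ₗ[ℝ] E))).image2 (fun w q => w x + q) h1).subset ?_
    rintro y ⟨⟨w, hw, q, hq, rfl⟩, hy⟩
    refine ⟨w, hw, q, ⟨?_, hq⟩, rfl⟩
    rw [mem_closedBall_zero_iff]
    have hwx : ‖w x‖ = ‖x‖ := by
      rw [← sq_eq_sq₀ (norm_nonneg _) (norm_nonneg _), ← real_inner_self_eq_norm_sq,
        ← real_inner_self_eq_norm_sq, inner_linearWeyl hw]
    have h2 : q = (w x + q - x₀) + x₀ - w x := by abel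
    calc ‖q‖ ≤ ‖(w x + q - x₀) + x₀‖ + ‖w x‖ := by
          conv_lhs => rw [h2]
          exact norm_sub_le _ _
      _ ≤ ‖w x + q - x₀‖ + ‖x₀‖ + ‖w x‖ := by gcongr; exact norm_add_le _ _
      _ ≤ _ := by rw [hwx]; gcongr
  obtain ⟨y, ⟨⟨w, hw, q, hq, rfl⟩, hy⟩, hmin⟩ := Set.exists_min_image Y (fun y => ‖y - x₀‖) hY
    ⟨x, ⟨1, one_mem _, 0, zero_mem _, by simp⟩, le_rfl⟩
  refine ⟨w, hw, q, hq, mem_closedAlcove.2 fun d hd => ?_⟩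
  by_contra! hneg
  have hlt : ‖affineReflection P d (w x + q) - x₀‖ < ‖w x + q - x₀‖ := by
    rw [← sq_lt_sq₀ (norm_nonneg _) (norm_nonneg _), norm_affineReflection_sub_sq]
    have h1 := div_pos two_pos (inner_root_self_pos (P := P) d.1)
    have h2 := mul_pos (mul_pos h1 (neg_pos.2 hneg)) (hx₀ d hd)
    linarith
  refine absurd (hmin _ ⟨⟨P.reflection d.1 * w, mul_mem (reflection_mem_linearWeyl _) hw,
    P.reflection d.1 q - d.2 • P.coroot d.1, ?_, ?_⟩, hlt.le.trans hy⟩) (not_le.2 hlt)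
  · exact sub_mem (linearWeyl_apply_mem_corootLattice (reflection_mem_linearWeyl _) hq)
      ((corootLattice b).smul_mem _ (coroot_mem_corootLattice b _))
  · rw [affineReflection_eq, map_add, LinearEquiv.mul_apply, Int.cast_smul_eq_zsmul]
    abel

end Covering

/-! ### Determinants and the two cosets of the even Weyl group. -/

section EvenWeyl

variable {ι E : Type*} [NormedAddCommGroup E] [InnerProductSpace ℝ E]
  {P : RootPairing ι ℝ E E}

theorem mem_evenWeyl_iff {w : E ≃ₗ[ℝ] E} :
    w ∈ evenWeyl P ↔ w ∈ linearWeyl P ∧ LinearEquiv.det w = 1 := Iff.rfl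

/-- A reflection is $x\mapsto x+f(x)v$ with $f(v)=-2$, and such a map has determinant $1+f(v)$. -/
theorem det_reflection [FiniteDimensional ℝ E] (i : ι) :
    LinearEquiv.det (P.reflection i) = -1 := by
  have h : (P.reflection i : E →ₗ[ℝ] E) =
      LinearMap.transvection (-P.coroot' i) (P.root i) := by
    ext x
    simp [LinearMap.transvection.apply, RootPairing.reflection_apply, sub_eq_add_neg]
  ext
  rw [LinearEquiv.coe_det, h, LinearMap.transvection.det]
  norm_num

theorem reflection_mul_self (i : ι) : P.reflection i * P.reflection i = 1 := by
  rw [← sq, P.reflection_sq]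

theorem linearWeyl_det [FiniteDimensional ℝ E] {w : E ≃ₗ[ℝ] E} (hw : w ∈ linearWeyl P) :
    LinearEquiv.det w = 1 ∨ LinearEquiv.det w = -1 := by
  refine linearWeyl_induction (P := P)
    (p := fun w => LinearEquiv.det w = 1 ∨ LinearEquiv.det w = -1) (Or.inl (map_one _)) ?_ hw
  intro i w _ ih
  rw [map_mul, det_reflection]
  rcases ih with h | h <;> simp [h]

theorem mem_evenWeyl_or_mul_reflection_mem [FiniteDimensional ℝ E] (α : ι) {w : E ≃ₗ[ℝ] E}
    (hw : w ∈ linearWeyl P) : w ∈ evenWeyl P ∨ w * P.reflection α ∈ evenWeyl P := by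
  rcases linearWeyl_det hw with h | h
  · exact Or.inl (mem_evenWeyl_iff.2 ⟨hw, h⟩)
  · refine Or.inr (mem_evenWeyl_iff.2 ⟨mul_mem hw (reflection_mem_linearWeyl α), ?_⟩)
    rw [map_mul, h, det_reflection, neg_one_mul, neg_neg]

/-- An element of the Weyl group as a linear isometry. -/
noncomputable def linearWeylIsometry [IsEuclidean P] {w : E ≃ₗ[ℝ] E} (hw : w ∈ linearWeyl P) :
    E ≃ₗᵢ[ℝ] E :=
  ⟨w, fun x => by
    rw [← sq_eq_sq₀ (norm_nonneg _) (norm_nonneg _), ← real_inner_self_eq_norm_sq,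
      ← real_inner_self_eq_norm_sq, inner_linearWeyl hw]⟩

end EvenWeyl

/-! ### Measure-theoretic instances for the coroot lattice action. -/

section CorootLattice

variable {ι E : Type*} [NormedAddCommGroup E] [InnerProductSpace ℝ E] [FiniteDimensional ℝ E]
  {P : RootPairing ι ℝ E E} [P.IsRootSystem] {b : P.Base}

instance : Countable (corootLattice b) :=
  inferInstanceAs <| Countable (Submodule.span ℤ (Set.range b.toCoweightBasis))

variable [MeasurableSpace E] [BorelSpace E]

instance : MeasurableConstVAdd (corootLattice b) E :=
  inferInstanceAs <| MeasurableConstVAdd (corootLattice b).toAddSubgroup E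

instance : VAddInvariantMeasure (corootLattice b) E volume :=
  inferInstanceAs <| VAddInvariantMeasure (corootLattice b).toAddSubgroup E volume

end CorootLattice

/-! ### The doubled alcove as a fundamental domain; folding the torus integral. -/

section FundamentalDomain

variable {ι E : Type*} [NormedAddCommGroup E] [InnerProductSpace ℝ E]
  {P : RootPairing ι ℝ E E} (b : P.Base) (ξ α : ι)

/-- The union of the open alcove and of its mirror image. -/
def openEvenAlcove : Set E := openAlcove b ξ ∪ P.reflection α '' openAlcove b ξ

variable (P) in
/-- A point is regular if it lies on none of the reflection hyperplanes of the affine Weyl group. -/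
def IsRegular (x : E) : Prop := ∀ c : ι × ℤ, affineForm P c x ≠ 0

variable {b ξ α}

theorem isOpen_openAlcove : IsOpen (openAlcove b ξ) := by
  have : openAlcove b ξ = (⋂ i ∈ b.support, {x | 0 < ⟪x, P.root i⟫_ℝ}) ∩
      {x | ⟪x, P.root ξ⟫_ℝ < 1} := by
    ext x
    simp [mem_openAlcove]
  rw [this]
  refine (isOpen_biInter_finset fun i _ => ?_).inter ?_
  · exact isOpen_lt continuous_const (by fun_prop)
  · exact isOpen_lt (by fun_prop) continuous_const

theorem mem_openAlcove_of_isRegular {x : E} (hx : x ∈ closedAlcove b ξ) (h : IsRegular P x) :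
    x ∈ openAlcove b ξ := fun c hc =>
  lt_of_le_of_ne (mem_closedAlcove.1 hx c hc) (h c).symm

variable [IsEuclidean P]

theorem isOpen_openEvenAlcove : IsOpen (openEvenAlcove b ξ α) :=
  isOpen_openAlcove.union
    ((linearWeylIsometry (reflection_mem_linearWeyl (P := P) α)).toHomeomorph.isOpenMap _
      isOpen_openAlcove)

theorem isOpen_image_openEvenAlcove {w : E ≃ₗ[ℝ] E} (hw : w ∈ linearWeyl P) :
    IsOpen (w '' openEvenAlcove b ξ α) :=
  (linearWeylIsometry hw).toHomeomorph.isOpenMap _ isOpen_openEvenAlcove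

omit [IsEuclidean P] in
theorem mem_openEvenAlcove_iff {x : E} : x ∈ openEvenAlcove b ξ α ↔
    ∃ u ∈ linearWeyl P, (u = 1 ∨ u = P.reflection α) ∧ ∃ a ∈ openAlcove b ξ, x = u a := by
  constructor
  · rintro (h | ⟨a, ha, rfl⟩)
    · exact ⟨1, one_mem _, Or.inl rfl, x, h, rfl⟩
    · exact ⟨_, reflection_mem_linearWeyl α, Or.inr rfl, a, ha, rfl⟩
  · rintro ⟨u, -, rfl | rfl, a, ha, rfl⟩
    · exact Or.inl ha
    · exact Or.inr ⟨a, ha, rfl⟩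

variable [Finite ι] [P.IsRootSystem] [P.IsCrystallographic] [P.IsReduced]

theorem eq_of_linearWeyl_apply_add_eq (hξ : IsHighestRoot b ξ) {v v' : E ≃ₗ[ℝ] E}
    (hv : v ∈ linearWeyl P) (hv' : v' ∈ linearWeyl P) {q q' : E} (hq : q ∈ corootLattice b)
    (hq' : q' ∈ corootLattice b) {a a' : E} (ha : a ∈ openAlcove b ξ) (ha' : a' ∈ openAlcove b ξ)
    (h : v a + q = v' a' + q') : v = v' ∧ q = q' := by
  have e : (v'⁻¹ * v) a + v'⁻¹ (q - q') = a' := by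
    rw [LinearEquiv.mul_apply, ← map_add, LinearEquiv.coe_inv, LinearEquiv.symm_apply_eq,
      ← add_sub_assoc, h, add_sub_cancel_right]
  have hm := linearWeyl_apply_mem_corootLattice (inv_mem hv') (sub_mem hq hq')
  obtain ⟨h1, h2⟩ := eq_one_of_mem_openAlcove hξ ha (mul_mem (inv_mem hv') hv) hm (e.symm ▸ ha')
  refine ⟨(inv_mul_eq_one.1 h1).symm, sub_eq_zero.1 ?_⟩
  exact (LinearEquiv.map_eq_zero_iff _).1 h2

variable [FiniteDimensional ℝ E]

/-- Freeness of the full affine group gives $vu=v'u'$ with $u,u'\in\{1,r_\alpha\}$; determinants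
then force $u=u'$. -/
theorem eq_of_evenWeyl_apply_add_eq (hξ : IsHighestRoot b ξ) {v v' : E ≃ₗ[ℝ] E}
    (hv : v ∈ evenWeyl P) (hv' : v' ∈ evenWeyl P) {q q' : E} (hq : q ∈ corootLattice b)
    (hq' : q' ∈ corootLattice b) {a a' : E} (hm : a ∈ openEvenAlcove b ξ α)
    (hm' : a' ∈ openEvenAlcove b ξ α) (h : v a + q = v' a' + q') : v = v' ∧ q = q' := by
  obtain ⟨hvW, hvd⟩ := mem_evenWeyl_iff.1 hv
  obtain ⟨hvW', hvd'⟩ := mem_evenWeyl_iff.1 hv'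
  obtain ⟨u, hu, hu1, a, ha, rfl⟩ := mem_openEvenAlcove_iff.1 hm
  obtain ⟨u', hu', hu1', a', ha', rfl⟩ := mem_openEvenAlcove_iff.1 hm'
  obtain ⟨h1, h2⟩ := eq_of_linearWeyl_apply_add_eq hξ (mul_mem hvW hu) (mul_mem hvW' hu')
    hq hq' ha ha' h
  refine ⟨?_, h2⟩
  have hd : LinearEquiv.det u = LinearEquiv.det u' := by
    simpa [hvd, hvd'] using congrArg LinearEquiv.det h1
  have hne : (1 : ℝˣ) ≠ -1 := fun h => by
    have := congrArg Units.val h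
    norm_num at this
  have huu : u = u' := by
    rcases hu1 with rfl | rfl <;> rcases hu1' with rfl | rfl
    · rfl
    · rw [map_one, det_reflection] at hd
      exact absurd hd hne
    · rw [map_one, det_reflection] at hd
      exact absurd hd.symm hne
    · rfl
  rw [huu] at h1
  exact mul_right_cancel h1

theorem IsRegular.linearWeyl_apply_add (hξ : IsHighestRoot b ξ) {x : E} (hx : IsRegular P x)
    {w : E ≃ₗ[ℝ] E} (hw : w ∈ linearWeyl P) {q : E} (hq : q ∈ corootLattice b) :
    IsRegular P (w x + q) := by
  intro c
  obtain ⟨x₀, hx₀⟩ := openAlcove_nonempty b ξ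
  obtain ⟨L, hL, hLw⟩ := exists_list_prod_eq_of_mem_closure (affineMotion_mem_closure hξ hx₀ hw hq)
  obtain ⟨c', hc'⟩ := exists_affineForm_comp_list_prod hL c
  rw [← affineMotion_apply, ← hLw, ← hc']
  exact hx c'

theorem IsRegular.linearWeyl_apply (hξ : IsHighestRoot b ξ) {x : E} (hx : IsRegular P x)
    {w : E ≃ₗ[ℝ] E} (hw : w ∈ linearWeyl P) : IsRegular P (w x) := by
  simpa using hx.linearWeyl_apply_add hξ hw (zero_mem (corootLattice b))

/-- The images of the even alcove under the even Weyl group. -/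
def evenAlcoveOrbit (b : P.Base) (ξ α : ι) : Set E :=
  ⋃ w : evenWeyl P, w.1 '' openEvenAlcove b ξ α

theorem IsRegular.exists_add_mem_evenAlcoveOrbit (hξ : IsHighestRoot b ξ) {x : E}
    (hx : IsRegular P x) : ∃ q ∈ corootLattice b, q + x ∈ evenAlcoveOrbit b ξ α := by
  obtain ⟨w, hw, q, hq, h⟩ := exists_apply_add_mem_closedAlcove (b := b) (ξ := ξ) x
  have hA := mem_openAlcove_of_isRegular h (hx.linearWeyl_apply_add hξ hw hq)
  refine ⟨w⁻¹ q, linearWeyl_apply_mem_corootLattice (inv_mem hw) hq, Set.mem_iUnion.2 ?_⟩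
  have e : w⁻¹ q + x = w⁻¹ (w x + q) := by
    rw [map_add, add_comm, LinearEquiv.coe_inv, LinearEquiv.symm_apply_apply]
  rw [e]
  rcases mem_evenWeyl_or_mul_reflection_mem α (inv_mem hw) with h1 | h1
  · exact ⟨⟨_, h1⟩, _, Or.inl hA, rfl⟩
  · refine ⟨⟨_, h1⟩, _, Or.inr ⟨_, hA, rfl⟩, ?_⟩
    simp only [LinearEquiv.mul_apply, P.reflection_same]

theorem IsRegular.mem_closedEvenAlcove_iff (hξ : IsHighestRoot b ξ) {x : E} (hx : IsRegular P x) :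
    x ∈ closedEvenAlcove b ξ α ↔ x ∈ openEvenAlcove b ξ α := by
  constructor
  · rintro (h | ⟨y, hy, rfl⟩)
    · exact Or.inl (mem_openAlcove_of_isRegular h hx)
    · refine Or.inr ⟨y, mem_openAlcove_of_isRegular hy ?_, rfl⟩
      have := hx.linearWeyl_apply hξ (reflection_mem_linearWeyl α)
      rwa [P.reflection_same] at this
  · exact fun h => h.imp (fun h => openAlcove_subset_closedAlcove h)
      fun h => Set.image_mono openAlcove_subset_closedAlcove h

variable [MeasurableSpace E] [BorelSpace E]

omit [IsEuclidean P] [P.IsRootSystem] [P.IsCrystallographic] [P.IsReduced] in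
variable (P) in
-- The irregular points form a countable union of affine hyperplanes, each a translate of a proper
-- subspace.
theorem ae_isRegular : ∀ᵐ x : E, IsRegular P x := by
  refine ae_all_iff.2 fun c => ?_
  have h1 : (volume : Measure E) ((ℝ ∙ P.root c.1)ᗮ : Submodule ℝ E) = 0 := by
    refine Measure.addHaar_submodule _ _ fun h => P.ne_zero c.1 ?_
    have h2 : P.root c.1 ∈ (ℝ ∙ P.root c.1)ᗮ := h ▸ Submodule.mem_top
    rw [Submodule.mem_orthogonal_singleton_iff_inner_left] at h2
    exact inner_self_eq_zero.1 h2
  have hne : ⟪P.root c.1, P.root c.1⟫_ℝ ≠ 0 := inner_self_ne_zero.2 (P.ne_zero c.1)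
  rw [← measure_preimage_add_right volume
    (((c.2 : ℝ) / ⟪P.root c.1, P.root c.1⟫_ℝ) • P.root c.1)] at h1
  rw [ae_iff]
  convert h1 using 2
  ext x
  simp only [Set.mem_ofPred_eq, not_not, Set.mem_preimage, SetLike.mem_coe,
    Submodule.mem_orthogonal_singleton_iff_inner_left, inner_add_left, inner_smul_left, affineForm,
    RCLike.conj_to_real, div_mul_cancel₀ _ hne]

theorem closedEvenAlcove_ae_eq (hξ : IsHighestRoot b ξ) :
    (closedEvenAlcove b ξ α : Set E) =ᵐ[volume] openEvenAlcove b ξ α := by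
  filter_upwards [ae_isRegular P] with x hx
  exact propext (hx.mem_closedEvenAlcove_iff hξ)

omit [FiniteDimensional ℝ E] [Finite ι] [P.IsRootSystem] [P.IsCrystallographic] [P.IsReduced] in
theorem measurableSet_evenAlcoveOrbit : MeasurableSet (evenAlcoveOrbit b ξ α) :=
  (isOpen_iUnion fun w => isOpen_image_openEvenAlcove w.2.1).measurableSet

/-- The images of the even alcove under the even Weyl group form a fundamental domain of the coroot
lattice. -/
theorem isAddFundamentalDomain_evenAlcoveOrbit (hξ : IsHighestRoot b ξ) :
    IsAddFundamentalDomain (corootLattice b) (evenAlcoveOrbit b ξ α) (volume : Measure E) where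
  nullMeasurableSet := measurableSet_evenAlcoveOrbit.nullMeasurableSet
  ae_covers := by
    filter_upwards [ae_isRegular P] with x hx
    obtain ⟨q, hq, h⟩ := hx.exists_add_mem_evenAlcoveOrbit (α := α) hξ
    exact ⟨⟨q, hq⟩, h⟩
  aedisjoint := by
    intro q q' hne
    refine Disjoint.aedisjoint (Set.disjoint_left.2 ?_)
    rintro _ ⟨x, hx, rfl⟩ ⟨x', hx', h⟩
    obtain ⟨w, a, ha, rfl⟩ := Set.mem_iUnion.1 hx
    obtain ⟨w', a', ha', rfl⟩ := Set.mem_iUnion.1 hx'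
    refine hne (Subtype.ext ?_)
    refine (eq_of_evenWeyl_apply_add_eq hξ w.2 w'.2 q.2 q'.2 ha ha' ?_).2
    rw [add_comm, add_comm (w'.1 a')]
    exact h.symm

omit [IsEuclidean P] [Finite ι] [P.IsCrystallographic] [P.IsReduced] in
theorem isAddFundamentalDomain_torus :
    IsAddFundamentalDomain (corootLattice b) (torus b) (volume : Measure E) :=
  ZSpan.isAddFundamentalDomain b.toCoweightBasis volume

omit [IsEuclidean P] [Finite ι] [P.IsCrystallographic] [P.IsReduced] in
theorem volume_torus_ne_top : volume (torus b) ≠ ⊤ :=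
  (ZSpan.fundamentalDomain_isBounded b.toCoweightBasis).measure_lt_top.ne

omit [IsEuclidean P] [Finite ι] [P.IsCrystallographic] [P.IsReduced] in
theorem volume_torus_ne_zero : volume (torus b) ≠ 0 :=
  ZSpan.measure_fundamentalDomain_ne_zero b.toCoweightBasis

/-- Up to a null set it lies in a fundamental domain with the same volume as the bounded torus. -/
theorem volume_closedEvenAlcove_ne_top (hξ : IsHighestRoot b ξ) :
    volume (closedEvenAlcove b ξ α : Set E) ≠ ⊤ := by
  rw [measure_congr (closedEvenAlcove_ae_eq hξ)]
  refine ne_top_of_le_ne_top (volume_torus_ne_top (b := b)) ?_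
  rw [isAddFundamentalDomain_torus.measure_eq (isAddFundamentalDomain_evenAlcoveOrbit (α := α) hξ)]
  exact measure_mono fun x hx => Set.mem_iUnion.2 ⟨⟨1, one_mem _⟩, x, hx, rfl⟩

/-- The integral over the torus of a function invariant under the even affine Weyl group. -/
theorem setIntegral_torus_eq (hξ : IsHighestRoot b ξ) {f : E → ℂ}
    (hW : ∀ w ∈ evenWeyl P, ∀ x, f (w x) = f x) (hQ : ∀ q ∈ corootLattice b, ∀ x, f (q + x) = f x)
    (hf : IntegrableOn f (torus b)) :
    ∫ x in torus b, f x = evenOrder P * ∫ x in closedEvenAlcove b ξ α, f x := by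
  have := finite_evenWeyl P
  have := Fintype.ofFinite (evenWeyl P)
  have hT := isAddFundamentalDomain_torus (b := b)
  have hD := isAddFundamentalDomain_evenAlcoveOrbit (α := α) hξ
  have hinv : ∀ (q : corootLattice b) (x : E), f (q +ᵥ x) = f x := fun q x => hQ q q.2 x
  have hfD : IntegrableOn f (evenAlcoveOrbit b ξ α) := (hT.integrableOn_iff hD hinv).1 hf
  rw [hT.setIntegral_eq hD hinv, evenAlcoveOrbit, integral_iUnion_fintype]
  · have : ∀ w : evenWeyl P, ∫ x in w.1 '' openEvenAlcove b ξ α, f x =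
        ∫ x in openEvenAlcove b ξ α, f x := by
      intro w
      let e := linearWeylIsometry w.2.1
      have h := e.measurePreserving.setIntegral_image_emb
        e.toHomeomorph.measurableEmbedding f (openEvenAlcove b ξ α)
      refine h.trans (setIntegral_congr_fun isOpen_openEvenAlcove.measurableSet fun x _ => ?_)
      exact hW w w.2 x
    rw [Finset.sum_congr rfl fun w _ => this w, Finset.sum_const, Finset.card_univ,
      setIntegral_congr_set (closedEvenAlcove_ae_eq hξ), nsmul_eq_mul, evenOrder,
      Nat.card_eq_fintype_card]
  · exact fun w => (isOpen_image_openEvenAlcove w.2.1).measurableSet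
  · intro w w' hne
    refine Set.disjoint_left.2 ?_
    rintro _ ⟨a, ha, rfl⟩ ⟨a', ha', h⟩
    exact hne (Subtype.ext (eq_of_evenWeyl_apply_add_eq hξ w.2 w'.2 (zero_mem _)
      (zero_mem (corootLattice b)) ha ha' (by simpa using h.symm)).1)
  · exact fun w => hfD.mono_set (Set.subset_iUnion (fun w : evenWeyl P => w.1 '' _) w)

end FundamentalDomain

/-! ### Exponential characters. -/

section Characters

variable {E : Type*} [NormedAddCommGroup E] [InnerProductSpace ℝ E]

/-- The character `x ↦ exp (2 π i ⟨η, x⟩)`. -/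
noncomputable def character (η x : E) : ℂ :=
  Complex.exp (2 * Real.pi * Complex.I * (⟪η, x⟫_ℝ : ℂ))

@[fun_prop]
theorem continuous_character (η : E) : Continuous (character η) := by
  unfold character
  fun_prop

theorem norm_character (η x : E) : ‖character η x‖ = 1 := by
  have : (2 * Real.pi * Complex.I * (⟪η, x⟫_ℝ : ℂ) : ℂ) =
      ((2 * Real.pi * ⟪η, x⟫_ℝ : ℝ) : ℂ) * Complex.I := by
    push_cast
    ring
  rw [character, this, Complex.norm_exp_ofReal_mul_I]

theorem character_add_right (η x y : E) : character η (x + y) = character η x * character η y := by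
  rw [character, character, character, ← Complex.exp_add, inner_add_right]
  push_cast
  ring_nf

theorem character_mul_conj (η η' x : E) :
    character η x * conj (character η' x) = character (η - η') x := by
  rw [character, character, character, ← Complex.exp_conj, ← Complex.exp_add, inner_sub_left]
  congr 1
  simp only [map_mul, Complex.conj_ofReal, Complex.conj_I, map_ofNat]
  push_cast
  ring

theorem character_eq_one {η q : E} (h : ∃ m : ℤ, ⟪η, q⟫_ℝ = m) : character η q = 1 := by
  obtain ⟨m, hm⟩ := h
  rw [character, hm, Complex.exp_eq_one_iff]
  exact ⟨m, by push_cast; ring⟩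

theorem character_zero_left (x : E) : character 0 x = 1 :=
  character_eq_one ⟨0, by simp⟩

end Characters

/-! ### Integral weights and the vanishing of character integrals. -/

section Weights

variable {ι E : Type*} [NormedAddCommGroup E] [InnerProductSpace ℝ E]
  {P : RootPairing ι ℝ E E} {b : P.Base} [P.IsRootSystem]

/-- Testing against the whole coroot lattice, which $W$ preserves, makes $W$-invariance of the
weights immediate. -/
theorem mem_weightLattice_iff {lam : E} :
    lam ∈ weightLattice b ↔ ∀ q ∈ corootLattice b, ∃ m : ℤ, ⟪lam, q⟫_ℝ = m := by
  constructor
  · intro h q hq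
    rw [corootLattice_eq] at hq
    induction hq using Submodule.span_induction with
    | mem x hx =>
      obtain ⟨i, hi, rfl⟩ := hx
      exact h i hi
    | zero => exact ⟨0, by simp⟩
    | add x y _ _ hx hy =>
      obtain ⟨m, hm⟩ := hx
      obtain ⟨n, hn⟩ := hy
      exact ⟨m + n, by rw [inner_add_right, hm, hn]; push_cast; rfl⟩
    | smul n x _ hx =>
      obtain ⟨m, hm⟩ := hx
      refine ⟨n * m, ?_⟩
      rw [← Int.cast_smul_eq_zsmul ℝ, inner_smul_right, hm]
      push_cast
      rfl
  · exact fun h i _ => h _ (coroot_mem_corootLattice b i)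

omit [P.IsRootSystem] in
theorem sub_mem_weightLattice {lam lam' : E} (h : lam ∈ weightLattice b)
    (h' : lam' ∈ weightLattice b) : lam - lam' ∈ weightLattice b := by
  intro i hi
  obtain ⟨m, hm⟩ := h i hi
  obtain ⟨n, hn⟩ := h' i hi
  exact ⟨m - n, by rw [inner_sub_left, hm, hn]; push_cast; rfl⟩

theorem linearWeyl_apply_mem_weightLattice [IsEuclidean P] {w : E ≃ₗ[ℝ] E}
    (hw : w ∈ linearWeyl P) {lam : E} (h : lam ∈ weightLattice b) : w lam ∈ weightLattice b := by
  rw [mem_weightLattice_iff] at h ⊢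
  intro q hq
  have e : ⟪w lam, q⟫_ℝ = ⟪lam, w⁻¹ q⟫_ℝ := by
    rw [← inner_linearWeyl hw lam, LinearEquiv.coe_inv, LinearEquiv.apply_symm_apply]
  rw [e]
  exact h _ (linearWeyl_apply_mem_corootLattice (inv_mem hw) hq)

theorem character_add_of_mem_corootLattice {η q : E} (hη : η ∈ weightLattice b)
    (hq : q ∈ corootLattice b) (x : E) : character η (q + x) = character η x := by
  rw [character_add_right, character_eq_one (mem_weightLattice_iff.1 hη q hq), one_mul]

variable [FiniteDimensional ℝ E] [MeasurableSpace E] [BorelSpace E]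

/-- A nontrivial character of the torus has mean zero. -/
theorem setIntegral_torus_character_eq_zero {η : E} (hη : η ∈ weightLattice b) (h0 : η ≠ 0) :
    ∫ x in torus b, character η x = 0 := by
  have hne : ⟪η, η⟫_ℝ ≠ 0 := inner_self_ne_zero.2 h0
  -- Chosen with $\langle\eta,v\rangle=1/2$, so translation by $v$ negates the character. The
  -- translated torus is again a fundamental domain, so the integral equals its own negative.
  let v : E := (1 / (2 * ⟪η, η⟫_ℝ)) • η
  have hv : character η v = -1 := by
    have : ⟪η, v⟫_ℝ = 1 / 2 := by
      simp only [v, inner_smul_right]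
      field_simp
    rw [character, this]
    convert Complex.exp_pi_mul_I using 2
    push_cast
    ring
  have hT := isAddFundamentalDomain_torus (b := b)
  have h1 := hT.setIntegral_eq (hT.vadd_of_comm v) (f := character η)
    fun q x => character_add_of_mem_corootLattice hη q.2 x
  have h2 := (measurePreserving_vadd v (volume : Measure E)).setIntegral_image_emb
    (measurableEmbedding_const_vadd v) (character η) (torus b)
  rw [Set.image_vadd] at h2
  rw [h2] at h1
  simp only [vadd_eq_add, character_add_right, hv, neg_one_mul, integral_neg] at h1
  exact self_eq_neg.1 h1

end Weights

/-! ### Orthogonality of orbit functions on the torus and on the even alcove. -/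

section OrbitFunctions

variable {ι E : Type*} [Finite ι] [NormedAddCommGroup E] [InnerProductSpace ℝ E]
  {P : RootPairing ι ℝ E E} [P.IsRootSystem]

variable (P) in
theorem evenOrbit_finite (lam : E) : (evenOrbit P lam).Finite := by
  have := finite_evenWeyl P
  exact Set.finite_range _

variable (P) in
theorem orbitFunction_eq_sum (lam x : E) :
    orbitFunction P lam x = ∑ μ ∈ (evenOrbit_finite P lam).toFinset, character μ x :=
  finsum_mem_eq_finite_toFinset_sum _ _

theorem continuous_orbitFunction (lam : E) : Continuous (orbitFunction P lam) := by
  have : orbitFunction P lam =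
      fun x => ∑ μ ∈ (evenOrbit_finite P lam).toFinset, character μ x :=
    funext (orbitFunction_eq_sum P lam)
  rw [this]
  fun_prop

theorem norm_orbitFunction_le (lam x : E) :
    ‖orbitFunction P lam x‖ ≤ (evenOrbit_finite P lam).toFinset.card := by
  rw [orbitFunction_eq_sum]
  refine (norm_sum_le _ _).trans ?_
  simp [norm_character]

omit [Finite ι] [P.IsRootSystem] in
theorem apply_mem_evenOrbit_iff {w : E ≃ₗ[ℝ] E} (hw : w ∈ evenWeyl P) {lam μ : E} :
    w μ ∈ evenOrbit P lam ↔ μ ∈ evenOrbit P lam :=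
  ⟨fun h => by
    have := MulAction.mem_orbit_of_mem_orbit (⟨w, hw⟩ : evenWeyl P)⁻¹ h
    rwa [show w μ = (⟨w, hw⟩ : evenWeyl P) • μ from rfl, inv_smul_smul] at this,
    MulAction.mem_orbit_of_mem_orbit (⟨w, hw⟩ : evenWeyl P)⟩

omit [Finite ι] [P.IsRootSystem] in
theorem orbitFunction_apply_evenWeyl [IsEuclidean P] {w : E ≃ₗ[ℝ] E} (hw : w ∈ evenWeyl P)
    (lam x : E) : orbitFunction P lam (w x) = orbitFunction P lam x := by
  symm
  refine finsum_mem_eq_of_bijOn w ⟨?_, w.injective.injOn, ?_⟩ ?_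
  · exact fun μ hμ => (apply_mem_evenOrbit_iff hw).2 hμ
  · intro μ hμ
    refine ⟨w.symm μ, (apply_mem_evenOrbit_iff hw).1 ?_, w.apply_symm_apply μ⟩
    rwa [w.apply_symm_apply]
  · intro μ _
    rw [inner_linearWeyl hw.1]

variable {b : P.Base}

omit [Finite ι] in
theorem mem_weightLattice_of_mem_evenOrbit [IsEuclidean P] {lam μ : E}
    (h : lam ∈ weightLattice b) (hμ : μ ∈ evenOrbit P lam) : μ ∈ weightLattice b := by
  obtain ⟨w, rfl⟩ := hμ
  exact linearWeyl_apply_mem_weightLattice w.2.1 h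

theorem orbitFunction_add_of_mem_corootLattice [IsEuclidean P] {lam q : E}
    (h : lam ∈ weightLattice b) (hq : q ∈ corootLattice b) (x : E) :
    orbitFunction P lam (q + x) = orbitFunction P lam x := by
  rw [orbitFunction_eq_sum, orbitFunction_eq_sum]
  refine Finset.sum_congr rfl fun μ hμ => ?_
  rw [Set.Finite.mem_toFinset] at hμ
  exact character_add_of_mem_corootLattice (mem_weightLattice_of_mem_evenOrbit h hμ) hq x

omit [Finite ι] [P.IsRootSystem] in
theorem evenOrbit_eq_iff {lam lam' : E} :
    evenOrbit P lam = evenOrbit P lam' ↔ lam ∈ evenOrbit P lam' :=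
  MulAction.orbit_eq_iff

theorem card_evenOrbit_mul_stabilizerOrder (lam : E) :
    (evenOrbit_finite P lam).toFinset.card * stabilizerOrder P lam = evenOrder P := by
  rw [← Set.ncard_eq_toFinset_card _ (evenOrbit_finite P lam), evenOrder, stabilizerOrder]
  exact (congrArg (· * _) (Nat.card_coe_set_eq _).symm).trans
    (Nat.card_prod _ _ ▸ Nat.card_congr (MulAction.orbitProdStabilizerEquivGroup (evenWeyl P) lam))

theorem evenOrder_pos : 0 < evenOrder P := by
  have := finite_evenWeyl P
  exact Nat.card_pos

theorem stabilizerOrder_pos (lam : E) : 0 < stabilizerOrder P lam :=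
  Nat.pos_of_ne_zero fun h => (evenOrder_pos (P := P)).ne' <| by
    rw [← card_evenOrbit_mul_stabilizerOrder lam, h, mul_zero]

variable [MeasurableSpace E] [BorelSpace E] [FiniteDimensional ℝ E]

theorem integrableOn_orbitFunction_mul_conj {s : Set E} (hs : volume s ≠ ⊤) (lam lam' : E) :
    IntegrableOn (fun x => orbitFunction P lam x * conj (orbitFunction P lam' x)) s := by
  have hc : Continuous fun x => orbitFunction P lam x * conj (orbitFunction P lam' x) :=
    (continuous_orbitFunction lam).mul
      (Complex.continuous_conj.comp (continuous_orbitFunction lam'))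
  refine IntegrableOn.of_bound hs.lt_top hc.aestronglyMeasurable
    ((evenOrbit_finite P lam).toFinset.card * (evenOrbit_finite P lam').toFinset.card)
    (Filter.Eventually.of_forall fun x => ?_)
  rw [norm_mul, RCLike.norm_conj]
  exact mul_le_mul (norm_orbitFunction_le lam x) (norm_orbitFunction_le lam' x)
    (norm_nonneg _) (Nat.cast_nonneg _)

theorem setIntegral_torus_orbitFunction_mul_conj [IsEuclidean P] {lam lam' : E}
    (h : lam ∈ weightLattice b) (h' : lam' ∈ weightLattice b) :
    ∫ x in torus b, orbitFunction P lam x * conj (orbitFunction P lam' x) =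
      volume.real (torus b) * ((evenOrbit_finite P lam).toFinset.card *
        kronecker (evenOrbit P lam) (evenOrbit P lam')) := by
  classical
  have hint : ∀ η : E, IntegrableOn (character η) (torus b) := fun η =>
    IntegrableOn.of_bound (volume_torus_ne_top (b := b)).lt_top
      (continuous_character η).aestronglyMeasurable 1
      (Filter.Eventually.of_forall fun x => (norm_character η x).le)
  simp only [orbitFunction_eq_sum, map_sum, Finset.sum_mul_sum, character_mul_conj]
  rw [integral_finsetSum _ fun μ _ => integrable_finsetSum _ fun ν _ => hint _]
  have key : ∀ μ ∈ (evenOrbit_finite P lam).toFinset,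
      ∫ x in torus b, ∑ ν ∈ (evenOrbit_finite P lam').toFinset, character (μ - ν) x =
        volume.real (torus b) * kronecker (evenOrbit P lam) (evenOrbit P lam') := by
    intro μ hμ
    rw [Set.Finite.mem_toFinset] at hμ
    rw [integral_finsetSum _ fun ν _ => hint _]
    have hν : ∀ ν ∈ (evenOrbit_finite P lam').toFinset, ∫ x in torus b, character (μ - ν) x =
        if μ = ν then (volume.real (torus b) : ℂ) else 0 := by
      intro ν hν
      rw [Set.Finite.mem_toFinset] at hν
      split_ifs with hμν
      · simp [hμν, character_zero_left]
      · exact setIntegral_torus_character_eq_zero (sub_mem_weightLattice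
          (mem_weightLattice_of_mem_evenOrbit h hμ) (mem_weightLattice_of_mem_evenOrbit h' hν))
          (sub_ne_zero.2 hμν)
    rw [Finset.sum_congr rfl hν, Finset.sum_ite_eq, kronecker]
    have : μ ∈ (evenOrbit_finite P lam').toFinset ↔ evenOrbit P lam = evenOrbit P lam' := by
      rw [Set.Finite.mem_toFinset, ← evenOrbit_eq_iff, ← evenOrbit_eq_iff.2 hμ]
    simp only [this]
    split_ifs <;> simp
  rw [Finset.sum_congr rfl key, Finset.sum_const, nsmul_eq_mul]
  ring

omit [Finite ι] in
theorem torusMeasure_torus : torusMeasure b (torus b) = 1 := by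
  rw [torusMeasure, Measure.smul_apply, smul_eq_mul]
  exact ENNReal.inv_mul_cancel volume_torus_ne_zero volume_torus_ne_top

omit [Finite ι] in
theorem setIntegral_torusMeasure (s : Set E) (f : E → ℂ) :
    ∫ x in s, f x ∂(torusMeasure b) = (volume.real (torus b) : ℂ)⁻¹ * ∫ x in s, f x := by
  rw [torusMeasure, Measure.restrict_smul, integral_smul_measure, ENNReal.toReal_inv,
    Complex.real_smul, Complex.ofReal_inv]
  rfl

omit [Finite ι] in
theorem volume_real_torus_ne_zero : (volume.real (torus b) : ℂ) ≠ 0 :=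
  Complex.ofReal_ne_zero.2 (ENNReal.toReal_ne_zero.2 ⟨volume_torus_ne_zero, volume_torus_ne_top⟩)

variable [IsEuclidean P] [P.IsCrystallographic] [P.IsReduced] {ξ α : ι}

/-- The folding formula applied to the constant function $1$. -/
theorem volume_real_torus_eq (hξ : IsHighestRoot b ξ) :
    (volume.real (torus b) : ℂ) = evenOrder P * volume.real (closedEvenAlcove b ξ α : Set E) := by
  have := setIntegral_torus_eq (α := α) hξ (f := fun _ => 1) (fun _ _ _ => rfl) (fun _ _ _ => rfl)
    (integrableOn_const (volume_torus_ne_top (b := b)))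
  simpa using this

omit [P.IsCrystallographic] [P.IsReduced] in
/-- Orthogonality of orbit functions of integral weights on the torus. -/
theorem integral_torus_orbitFunction (b : P.Base) {lam lam' : E} (h : lam ∈ weightLattice b)
    (h' : lam' ∈ weightLattice b) :
    ∫ x in torus b, orbitFunction P lam x * conj (orbitFunction P lam' x) ∂(torusMeasure b) =
      (evenOrder P : ℂ) * (stabilizerOrder P lam : ℂ)⁻¹ *
        kronecker (evenOrbit P lam) (evenOrbit P lam') := by
  have hs : (stabilizerOrder P lam : ℂ) ≠ 0 := Nat.cast_ne_zero.2 (stabilizerOrder_pos lam).ne'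
  rw [setIntegral_torusMeasure, setIntegral_torus_orbitFunction_mul_conj h h',
    inv_mul_cancel_left₀ volume_real_torus_ne_zero, ← card_evenOrbit_mul_stabilizerOrder lam,
    Nat.cast_mul, mul_inv_cancel_right₀ hs]

/-- Orthogonality of orbit functions of integral weights on the even alcove. -/
theorem integral_closedEvenAlcove_orbitFunction (hξ : IsHighestRoot b ξ) {lam lam' : E}
    (h : lam ∈ weightLattice b) (h' : lam' ∈ weightLattice b) :
    ∫ x in closedEvenAlcove b ξ α,
        orbitFunction P lam x * conj (orbitFunction P lam' x) ∂(torusMeasure b) =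
      (stabilizerOrder P lam : ℂ)⁻¹ * kronecker (evenOrbit P lam) (evenOrbit P lam') := by
  have hW : (evenOrder P : ℂ) ≠ 0 := Nat.cast_ne_zero.2 evenOrder_pos.ne'
  have h1 := integral_torus_orbitFunction b h h'
  rw [setIntegral_torusMeasure, setIntegral_torus_eq (α := α) hξ ?_ ?_
    (integrableOn_orbitFunction_mul_conj volume_torus_ne_top lam lam')] at h1
  · rw [setIntegral_torusMeasure]
    apply mul_left_cancel₀ hW
    rw [← mul_assoc (evenOrder P : ℂ) (stabilizerOrder P lam : ℂ)⁻¹, ← h1]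
    ring
  · intro w hw x
    simp only [orbitFunction_apply_evenWeyl hw]
  · intro q hq x
    simp only [orbitFunction_add_of_mem_corootLattice h hq,
      orbitFunction_add_of_mem_corootLattice h' hq]

end OrbitFunctions

/-! ### Even orbits versus their representatives in the chamber. -/

section Representatives

variable {ι E : Type*} [Finite ι] [NormedAddCommGroup E] [InnerProductSpace ℝ E]
  [FiniteDimensional ℝ E] {P : RootPairing ι ℝ E E} [IsEuclidean P] [P.IsRootSystem]
  [P.IsCrystallographic] [P.IsReduced] {b : P.Base} {ξ α : ι}

omit [Finite ι] [IsEuclidean P] [P.IsRootSystem] [P.IsCrystallographic] [P.IsReduced] in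
theorem reflection_notMem_evenWeyl (α : ι) : P.reflection α ∉ evenWeyl P := by
  intro h
  have h1 := (mem_evenWeyl_iff.1 h).2
  rw [det_reflection] at h1
  have := congrArg Units.val h1
  norm_num at this

omit [Finite ι] [IsEuclidean P] [P.IsRootSystem] [P.IsCrystallographic] [P.IsReduced] in
theorem mul_reflection_ne_one {w : E ≃ₗ[ℝ] E} (hw : w ∈ evenWeyl P) (α : ι) :
    w * P.reflection α ≠ 1 := by
  intro h
  rw [mul_eq_one_iff_inv_eq] at h
  exact reflection_notMem_evenWeyl (P := P) α (h ▸ inv_mem hw)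

omit [Finite ι] [IsEuclidean P] [P.IsRootSystem] [P.IsCrystallographic] [P.IsReduced]
  [FiniteDimensional ℝ E] in
theorem mem_evenDominantChamber_iff {x : E} : x ∈ evenDominantChamber b α ↔
    ∃ u ∈ linearWeyl P, (u = 1 ∨ u = P.reflection α) ∧ ∃ a ∈ dominantChamber b, x = u a := by
  constructor
  · rintro (h | ⟨a, ha, rfl⟩)
    · exact ⟨1, one_mem _, Or.inl rfl, x, h, rfl⟩
    · exact ⟨_, reflection_mem_linearWeyl α, Or.inr rfl, a, ha, rfl⟩
  · rintro ⟨u, -, rfl | rfl, a, ha, rfl⟩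
    · exact Or.inl ha
    · exact Or.inr ⟨a, ha, rfl⟩

theorem dominant_eq_of_apply_eq (hξ : IsHighestRoot b ξ) {x y : E} (hx : x ∈ dominantChamber b)
    (hy : y ∈ dominantChamber b) {w : E ≃ₗ[ℝ] E} (hw : w ∈ linearWeyl P) (h : w x = y) : x = y := by
  obtain ⟨x₀, hx₀⟩ := openAlcove_nonempty b ξ
  rw [← h, eq_of_mem_dominantChamber hξ hx₀ hx hw (h.symm ▸ hy)]

omit [FiniteDimensional ℝ E] [Finite ι] [P.IsCrystallographic] [P.IsReduced] in
theorem evenDominantWeightsFull_subset_weightLattice :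
    evenDominantWeightsFull b α ⊆ weightLattice b := by
  rintro _ (h | ⟨x, hx, rfl⟩)
  · exact h.1
  · exact linearWeyl_apply_mem_weightLattice (reflection_mem_linearWeyl α) hx.1

omit [FiniteDimensional ℝ E] [Finite ι] [IsEuclidean P] [P.IsCrystallographic] [P.IsReduced]
  [P.IsRootSystem] in
theorem evenDominantWeightsFull_subset_evenDominantChamber :
    evenDominantWeightsFull b α ⊆ evenDominantChamber b α :=
  Set.union_subset_union Set.inter_subset_right (Set.image_mono Set.inter_subset_right)

omit [FiniteDimensional ℝ E] [Finite ι] [IsEuclidean P] [P.IsCrystallographic] [P.IsReduced]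
  [P.IsRootSystem] in
theorem evenDominantWeights_subset_full :
    evenDominantWeights b α ⊆ evenDominantWeightsFull b α :=
  Set.union_subset_union_right _ (Set.image_mono fun _ hx => ⟨hx.1, fun i hi => (hx.2 i hi).le⟩)

/-- Equality would force $wr_\alpha=1$, impossible for $w$ of determinant $1$. -/
theorem apply_reflection_ne_of_strictly_dominant (hξ : IsHighestRoot b ξ) {x y : E}
    (hx : ∀ i ∈ b.support, 0 < ⟪x, P.root i⟫_ℝ) (hy : y ∈ dominantChamber b)
    {w : E ≃ₗ[ℝ] E} (hw : w ∈ evenWeyl P) : w (P.reflection α x) ≠ y := fun h =>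
  mul_reflection_ne_one hw α (eq_one_of_strictly_dominant hξ hx
    (mul_mem hw.1 (reflection_mem_linearWeyl α)) (h.symm ▸ hy))

/-- The weights in `P^e_+` represent distinct orbits of the even Weyl group. -/
theorem eq_of_evenOrbit_eq (hξ : IsHighestRoot b ξ) {lam lam' : E}
    (h : lam ∈ evenDominantWeights b α) (h' : lam' ∈ evenDominantWeights b α)
    (heq : evenOrbit P lam = evenOrbit P lam') : lam = lam' := by
  obtain ⟨⟨w, hw⟩, hww⟩ := evenOrbit_eq_iff.1 heq
  change w lam' = lam at hww
  rcases h with h | ⟨x, hx, rfl⟩ <;> rcases h' with h' | ⟨x', hx', rfl⟩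
  · exact (dominant_eq_of_apply_eq hξ h'.2 h.2 hw.1 hww).symm
  · exact absurd hww (apply_reflection_ne_of_strictly_dominant hξ hx'.2 h.2 hw)
  · refine absurd ?_ (apply_reflection_ne_of_strictly_dominant (α := α) hξ hx.2 h'.2 (inv_mem hw))
    rw [← hww, LinearEquiv.coe_inv, LinearEquiv.symm_apply_apply]
  · have h1 : (P.reflection α * w * P.reflection α) x' = x := by
      rw [LinearEquiv.mul_apply, LinearEquiv.mul_apply, hww, P.reflection_same]
    have hr := reflection_mem_linearWeyl (P := P) α
    rw [dominant_eq_of_apply_eq hξ (fun i hi => (hx'.2 i hi).le) (fun i hi => (hx.2 i hi).le)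
      (mul_mem (mul_mem hr hw.1) hr) h1]

/-- The stabilizer in the Weyl group of a point in the interior of the even dominant chamber. -/
theorem eq_one_or_reflection_of_fixes_interior (hξ : IsHighestRoot b ξ) {lam : E}
    (h : lam ∈ interior (evenDominantChamber b α)) {v : E ≃ₗ[ℝ] E} (hv : v ∈ linearWeyl P)
    (hfix : v lam = lam) : v = 1 ∨ v = P.reflection α := by
  obtain ⟨x₀, hx₀⟩ := openAlcove_nonempty b ξ
  obtain ⟨u, hu, hu1, μ, hμ, rfl⟩ := mem_evenDominantChamber_iff.1 (interior_subset h)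
  -- Since $v$ fixes $u\mu$, this point is $vu(\mu+tx_0)$, the image of a strictly dominant vector
  -- for $t>0$. For small $t$ it stays in $D^e_+$, so freeness on the open chamber gives
  -- $vu\in\{1,r_\alpha\}$.
  have hcont : Filter.Tendsto (fun t : ℝ => u μ + t • v (u x₀)) (nhds 0) (nhds (u μ)) := by
    have : Continuous fun t : ℝ => u μ + t • v (u x₀) := by fun_prop
    simpa using this.tendsto 0
  have hev := (hcont.eventually (mem_interior_iff_mem_nhds.1 h)).filter_mono
    (nhdsWithin_le_nhds (s := Set.Ioi 0))
  obtain ⟨t, ht, ht0⟩ := (hev.and self_mem_nhdsWithin).exists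
  have hz : ∀ i ∈ b.support, 0 < ⟪μ + t • x₀, P.root i⟫_ℝ := by
    intro i hi
    rw [inner_add_left, inner_smul_left]
    exact add_pos_of_nonneg_of_pos (hμ i hi) (mul_pos ht0 ((mem_openAlcove.1 hx₀).1 i hi))
  have e : u μ + t • v (u x₀) = (v * u) (μ + t • x₀) := by
    rw [LinearEquiv.mul_apply, map_add, map_add, hfix, map_smul, map_smul]
  have hr := reflection_mem_linearWeyl (P := P) α
  have hrr := reflection_mul_self (P := P) α
  have hvu : v * u = 1 ∨ P.reflection α * (v * u) = 1 := by
    rcases ht with ht | ⟨y, hy, hy'⟩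
    · exact Or.inl (eq_one_of_strictly_dominant hξ hz (mul_mem hv hu) (e ▸ ht))
    · refine Or.inr (eq_one_of_strictly_dominant hξ hz (mul_mem hr (mul_mem hv hu)) ?_)
      rwa [LinearEquiv.mul_apply, ← e, ← hy', P.reflection_same]
  rcases hu1 with rfl | rfl
  · rw [mul_one] at hvu
    exact hvu.imp_right fun h => mul_left_cancel (h.trans hrr.symm)
  · rcases hvu with hvu | hvu
    · exact Or.inr (mul_right_cancel (hvu.trans hrr.symm))
    · left
      have := mul_left_cancel (hvu.trans hrr.symm)
      exact mul_right_cancel (this.trans (one_mul _).symm)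

theorem eq_one_of_fixes_interior (hξ : IsHighestRoot b ξ) {lam : E}
    (h : lam ∈ interior (evenDominantChamber b α)) {v : E ≃ₗ[ℝ] E} (hv : v ∈ evenWeyl P)
    (hfix : v lam = lam) : v = 1 :=
  (eq_one_or_reflection_of_fixes_interior hξ h hv.1 hfix).resolve_right fun h =>
    reflection_notMem_evenWeyl (P := P) α (h ▸ hv)

theorem stabilizerOrder_eq_one (hξ : IsHighestRoot b ξ) {lam : E}
    (h : lam ∈ interior (evenDominantChamber b α)) : stabilizerOrder P lam = 1 := by
  have : evenStabilizer P lam = ⊥ := by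
    refine (Subgroup.eq_bot_iff_forall _).2 fun w hw => Subtype.ext ?_
    exact eq_one_of_fixes_interior hξ h w.2 hw
  rw [stabilizerOrder, this, Subgroup.card_bot]

theorem eq_of_evenOrbit_eq_of_mem_interior (hξ : IsHighestRoot b ξ) {lam lam' : E}
    (h : lam ∈ interior (evenDominantChamber b α)) (h' : lam' ∈ evenDominantChamber b α)
    (heq : evenOrbit P lam = evenOrbit P lam') : lam = lam' := by
  obtain ⟨⟨w, hw⟩, hww⟩ := evenOrbit_eq_iff.1 heq.symm
  change w lam = lam' at hww
  -- Here $r_\alpha w$ fixes `lam`, so it is $1$ or $r_\alpha$; the first would make $w=r_\alpha$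
  -- odd, and the second gives $w=1$.
  have hrefl : P.reflection α lam = lam' → lam = lam' := by
    intro hr
    have hfix : (P.reflection α * w) lam = lam := by
      rw [LinearEquiv.mul_apply, hww, ← hr, P.reflection_same]
    rcases eq_one_or_reflection_of_fixes_interior hξ h
      (mul_mem (reflection_mem_linearWeyl α) hw.1) hfix with h1 | h1
    · rw [mul_eq_one_iff_inv_eq, P.reflection_inv] at h1
      exact absurd (h1 ▸ hw) (reflection_notMem_evenWeyl α)
    · rw [mul_eq_left] at h1
      rw [← hww, h1]
      rfl
  obtain ⟨u, hu, hu1, μ, hμ, e⟩ := mem_evenDominantChamber_iff.1 (interior_subset h)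
  obtain ⟨u', hu', hu1', μ', hμ', e'⟩ := mem_evenDominantChamber_iff.1 h'
  have hμμ : μ = μ' := by
    refine dominant_eq_of_apply_eq hξ hμ hμ' (mul_mem (inv_mem hu') (mul_mem hw.1 hu)) ?_
    rw [LinearEquiv.mul_apply, LinearEquiv.mul_apply, ← e, hww, e', LinearEquiv.coe_inv,
      LinearEquiv.symm_apply_apply]
  subst hμμ
  rcases hu1 with rfl | rfl <;> rcases hu1' with rfl | rfl
  · rw [e, e']
  · exact hrefl (by rw [e, e']; rfl)
  · exact hrefl (by rw [e, e', P.reflection_same]; rfl)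
  · rw [e, e']

theorem kronecker_congr {X Y : Type*} {a b : X} {c d : Y} (h : a = b ↔ c = d) :
    kronecker a b = kronecker c d := by
  classical
  unfold kronecker
  split_ifs <;> tauto

end Representatives

/-! ### Passing between Lebesgue measure and the normalized torus measure. -/

section Normalization

variable {ι E : Type*} [Finite ι] [NormedAddCommGroup E] [InnerProductSpace ℝ E]
  [FiniteDimensional ℝ E] [MeasurableSpace E] [BorelSpace E]
  {P : RootPairing ι ℝ E E} [IsEuclidean P] [P.IsRootSystem]
  [P.IsCrystallographic] [P.IsReduced] {b : P.Base} {ξ α : ι}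

theorem inv_volume_closedEvenAlcove_mul (hξ : IsHighestRoot b ξ) (f : E → ℂ) :
    (volume.real (closedEvenAlcove b ξ α) : ℂ)⁻¹ * ∫ x in closedEvenAlcove b ξ α, f x =
      evenOrder P * ∫ x in closedEvenAlcove b ξ α, f x ∂(torusMeasure b) := by
  have hW : (evenOrder P : ℂ) ≠ 0 := Nat.cast_ne_zero.2 evenOrder_pos.ne'
  rw [setIntegral_torusMeasure, volume_real_torus_eq (α := α) hξ, mul_inv, ← mul_assoc,
    mul_inv_cancel_left₀ hW]

theorem torusMeasure_real_closedEvenAlcove (hξ : IsHighestRoot b ξ) :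
    (torusMeasure b).real (closedEvenAlcove b ξ α) = (evenOrder P : ℝ)⁻¹ := by
  have h : volume.real (torus b) = evenOrder P * volume.real (closedEvenAlcove b ξ α : Set E) := by
    exact_mod_cast volume_real_torus_eq (α := α) hξ
  have h0 : volume.real (torus b) ≠ 0 :=
    ENNReal.toReal_ne_zero.2 ⟨volume_torus_ne_zero, volume_torus_ne_top⟩
  rw [torusMeasure, measureReal_ennreal_smul_apply, ENNReal.toReal_inv]
  change (volume.real (torus b))⁻¹ * _ = _
  rw [h] at h0 ⊢
  have h1 := left_ne_zero_of_mul h0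
  have h2 := right_ne_zero_of_mul h0
  field_simp

end Normalization

end EOrbit


theorem mainTheorem9 {ι E : Type*} [Finite ι]
    [NormedAddCommGroup E] [InnerProductSpace ℝ E] [FiniteDimensional ℝ E]
    [MeasurableSpace E] [BorelSpace E]
    (P : RootPairing ι ℝ E E) [EOrbit.IsEuclidean P]
    [P.IsRootSystem] [P.IsCrystallographic] [P.IsReduced] [P.IsIrreducible]
    (b : P.Base) (ξ : ι) (hξ : EOrbit.IsHighestRoot b ξ) (α : ι) :
    -- integral weights inside the even dominant chamber
    (∀ lam ∈ EOrbit.evenDominantWeightsFull b α,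
      lam ∈ interior (EOrbit.evenDominantChamber b α) →
      ∀ lam' ∈ EOrbit.evenDominantWeightsFull b α,
        ((volume.real (EOrbit.closedEvenAlcove b ξ α) : ℂ)⁻¹ *
            ∫ x in EOrbit.closedEvenAlcove b ξ α,
              EOrbit.orbitFunction P lam x * conj (EOrbit.orbitFunction P lam' x) =
          EOrbit.evenOrder P * EOrbit.kronecker lam lam') ∧
        (∫ x in EOrbit.torus b,
            EOrbit.orbitFunction P lam x * conj (EOrbit.orbitFunction P lam' x)
              ∂(EOrbit.torusMeasure b) =
          EOrbit.evenOrder P * EOrbit.kronecker lam lam') ∧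
        (∫ x in EOrbit.closedEvenAlcove b ξ α,
            EOrbit.orbitFunction P lam x * conj (EOrbit.orbitFunction P lam' x)
              ∂(EOrbit.torusMeasure b) =
          EOrbit.kronecker lam lam')) ∧
    -- all integral weights, in particular those on a wall of the even dominant chamber
    (∀ lam ∈ EOrbit.evenDominantWeights b α, ∀ lam' ∈ EOrbit.evenDominantWeights b α,
      ∫ x in EOrbit.closedEvenAlcove b ξ α,
          EOrbit.orbitFunction P lam x * conj (EOrbit.orbitFunction P lam' x)
            ∂(EOrbit.torusMeasure b) =
        (EOrbit.stabilizerOrder P lam : ℂ)⁻¹ * EOrbit.kronecker lam lam') ∧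
    (∀ lam ∈ EOrbit.evenDominantWeightsFull b α, ∀ lam' ∈ EOrbit.evenDominantWeightsFull b α,
      ∫ x in EOrbit.closedEvenAlcove b ξ α,
          EOrbit.orbitFunction P lam x * conj (EOrbit.orbitFunction P lam' x)
            ∂(EOrbit.torusMeasure b) =
        (EOrbit.stabilizerOrder P lam : ℂ)⁻¹ *
          EOrbit.kronecker (EOrbit.evenOrbit P lam) (EOrbit.evenOrbit P lam')) ∧
    -- normalization of the volumes, and integrability
    EOrbit.torusMeasure b (EOrbit.torus b) = 1 ∧
    (EOrbit.torusMeasure b).real (EOrbit.closedEvenAlcove b ξ α) =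
      (EOrbit.evenOrder P : ℝ)⁻¹ ∧
    (∀ lam lam' : E,
      IntegrableOn
        (fun x => EOrbit.orbitFunction P lam x * conj (EOrbit.orbitFunction P lam' x))
        (EOrbit.closedEvenAlcove b ξ α) ∧
      IntegrableOn
        (fun x => EOrbit.orbitFunction P lam x * conj (EOrbit.orbitFunction P lam' x))
        (EOrbit.torus b)) := by
  have hfull := EOrbit.evenDominantWeightsFull_subset_weightLattice (b := b) (α := α)
  have hsub := EOrbit.evenDominantWeights_subset_full (b := b) (α := α)
  refine ⟨?_, ?_, ?_, EOrbit.torusMeasure_torus, EOrbit.torusMeasure_real_closedEvenAlcove hξ, ?_⟩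
  · intro lam hlam hint lam' hlam'
    have hk : EOrbit.kronecker (EOrbit.evenOrbit P lam) (EOrbit.evenOrbit P lam') =
        EOrbit.kronecker lam lam' :=
      EOrbit.kronecker_congr ⟨EOrbit.eq_of_evenOrbit_eq_of_mem_interior hξ hint
        (EOrbit.evenDominantWeightsFull_subset_evenDominantChamber hlam'), fun h => h ▸ rfl⟩
    have hs := EOrbit.stabilizerOrder_eq_one hξ hint
    have hF := EOrbit.integral_closedEvenAlcove_orbitFunction (α := α) hξ (hfull hlam)
      (hfull hlam')
    have hT := EOrbit.integral_torus_orbitFunction b (hfull hlam) (hfull hlam')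
    rw [hs, hk, Nat.cast_one, inv_one] at hF hT
    rw [one_mul] at hF
    rw [mul_one] at hT
    refine ⟨?_, hT, hF⟩
    rw [EOrbit.inv_volume_closedEvenAlcove_mul hξ, hF]
  · intro lam hlam lam' hlam'
    rw [EOrbit.integral_closedEvenAlcove_orbitFunction hξ (hfull (hsub hlam))
      (hfull (hsub hlam')), EOrbit.kronecker_congr
      ⟨EOrbit.eq_of_evenOrbit_eq hξ hlam hlam', fun h => h ▸ rfl⟩]
  · intro lam hlam lam' hlam'
    exact EOrbit.integral_closedEvenAlcove_orbitFunction hξ (hfull hlam) (hfull hlam')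
  · exact fun lam lam' =>
      ⟨EOrbit.integrableOn_orbitFunction_mul_conj (EOrbit.volume_closedEvenAlcove_ne_top hξ) _ _,
        EOrbit.integrableOn_orbitFunction_mul_conj EOrbit.volume_torus_ne_top _ _⟩
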